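/- \textbf{Theorem.} Let $(M,g)$ be a connected smooth Riemannian manifold without boundary, of dimension $n>2$, which is complete and non-compact. Let $0<m\le\infty$, let $\lambda\ge 0$ be a real constant (the non-expanding case), let $X$ be a smooth vector field on $M$, and suppose that $(M,g)$ is $m$-quasi Einstein with potential vector field $X$, that is, $$\mathrm{Ric}+\tfrac12\,\mathcal L_Xg-\tfrac1m\,X^\flat\otimes X^\flat=\lambda g ,$$ where $\tfrac1\infty=0$. Write $R$ for the scalar curvature, $dV$ for the Riemannian volume measure and $d$ for the Riemannian distance. Suppose that $\mathrm{Vol}(M)<\infty$ and that $X$ has finite global norm, $\int_M|X|^2\,dV<\infty$. Then: (i) $\int_M(\lambda n-R)\,dV\le 0$ in the following sense. For every $p\in M$ the limit $$\lim_{r\to\infty}\int_M\omega_{p,r}\,(\lambda n-R)\,dV,\qquad \omega_{p,r}(x)=\max\{0,\min\{1,\,2-d(x,p)/r\}\},$$ exists, is finite and is $\le 0$ (the weight $\omega_{p,r}$ equals $1$ on the ball $B(p,r)$ and $0$ outside $B(p,2r)$). If moreover the positive part or the negative part of $\lambda n-R$ has finite integral, then $\lambda n-R$ is integrable over $M$ and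 $\int_M(\lambda n-R)\,dV\le 0$ as an ordinary integral. (ii) There is an open ball of positive radius in $M$ on which $R\ge\lambda n$. -/

import Mathlib

open scoped Manifold ContDiff Bundle Topology

noncomputable section

/- Chart computations on a Riemannian `n`-manifold `M` (without boundary). A point `x₀ : M` selects the
preferred chart `φ = extChartAt (𝓡 n) x₀` of `M` around `x₀`; `y` is a point of the chart domain in
`ℝⁿ`, so that the corresponding point of `M` is `φ.symm y`. -/

namespace QuasiEinstein

section Chart

variable {n : ℕ} {M : Type*} [TopologicalSpace M] [ChartedSpace (EuclideanSpace ℝ (Fin n)) M]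

/-- The `i`-th standard unit vector of `ℝⁿ`. -/
def unitVec (i : Fin n) : EuclideanSpace ℝ (Fin n) := EuclideanSpace.single i 1

/-- The `i`-th partial derivative of a real function on `ℝⁿ`. -/
def partialDeriv (i : Fin n) (u : EuclideanSpace ℝ (Fin n) → ℝ)
    (y : EuclideanSpace ℝ (Fin n)) : ℝ :=
  fderiv ℝ u y (unitVec i)

/-- The coordinate vector field `∂ᵢ` of the chart at `x₀`, at the point with coordinates `y`. -/
def coordVec (x₀ : M) (y : EuclideanSpace ℝ (Fin n)) (i : Fin n) :
    TangentSpace (𝓡 n) ((extChartAt (𝓡 n) x₀).symm y) :=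
  mfderiv 𝓘(ℝ, EuclideanSpace ℝ (Fin n)) (𝓡 n) (extChartAt (𝓡 n) x₀).symm y (unitVec i)

/-- The components `vⁱ` of a tangent vector `v` at `p` in the chart at `x₀`: `v = ∑ᵢ vⁱ ∂ᵢ`. -/
def components (x₀ p : M) (v : TangentSpace (𝓡 n) p) : EuclideanSpace ℝ (Fin n) :=
  mfderiv (𝓡 n) 𝓘(ℝ, EuclideanSpace ℝ (Fin n)) (extChartAt (𝓡 n) x₀) p v

/-- The component `Xᵏ` of a vector field `X` in the chart at `x₀`, as a function of the
coordinates. -/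
def fieldComponent (X : ∀ p : M, TangentSpace (𝓡 n) p) (x₀ : M) (k : Fin n)
    (y : EuclideanSpace ℝ (Fin n)) : ℝ :=
  components x₀ ((extChartAt (𝓡 n) x₀).symm y) (X ((extChartAt (𝓡 n) x₀).symm y)) k

/-- The bilinear form on `T_p M` whose matrix in the coordinate frame of the chart at `p` is
`A`. -/
def formOfMatrix (A : Matrix (Fin n) (Fin n) ℝ) (p : M) (v w : TangentSpace (𝓡 n) p) : ℝ :=
  ∑ i, ∑ j, A i j * components p p v i * components p p w j

variable [Bundle.RiemannianBundle (fun p : M ↦ TangentSpace (𝓡 n) p)]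

/-- The matrix `g_{ij} = g(∂ᵢ, ∂ⱼ)` of the Riemannian metric in the chart at `x₀`. -/
def metricMatrix (x₀ : M) (y : EuclideanSpace ℝ (Fin n)) : Matrix (Fin n) (Fin n) ℝ :=
  Matrix.of fun i j ↦ inner ℝ (coordVec x₀ y i) (coordVec x₀ y j)

/-- `∂ₖ g_{ij}`. -/
def metricDeriv (x₀ : M) (k i j : Fin n) (y : EuclideanSpace ℝ (Fin n)) : ℝ :=
  partialDeriv k (fun z ↦ metricMatrix x₀ z i j) y

/-- The Christoffel symbols of the Levi-Civita connection,
`Γᵏ_{ij} = ½ ∑ₗ gᵏˡ (∂ᵢ g_{jl} + ∂ⱼ g_{il} - ∂ₗ g_{ij})`. -/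
def christoffel (x₀ : M) (k i j : Fin n) (y : EuclideanSpace ℝ (Fin n)) : ℝ :=
  (1 / 2) * ∑ l, (metricMatrix x₀ y)⁻¹ k l *
    (metricDeriv x₀ i j l y + metricDeriv x₀ j i l y - metricDeriv x₀ l i j y)

/-- The components of the Ricci tensor,
`R_{ij} = ∑ₖ (∂ₖ Γᵏ_{ij} - ∂ⱼ Γᵏ_{ik}) + ∑ₖₗ (Γᵏ_{kl} Γˡ_{ij} - Γᵏ_{jl} Γˡ_{ik})`. -/
def ricciMatrix (x₀ : M) (y : EuclideanSpace ℝ (Fin n)) : Matrix (Fin n) (Fin n) ℝ :=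
  Matrix.of fun i j ↦
    ∑ k, (partialDeriv k (christoffel x₀ k i j) y - partialDeriv j (christoffel x₀ k i k) y)
    + ∑ k, ∑ l, (christoffel x₀ k k l y * christoffel x₀ l i j y
        - christoffel x₀ k j l y * christoffel x₀ l i k y)

/-- The components of the Lie derivative `£_X g`,
`(£_X g)_{ij} = ∑ₖ (Xᵏ ∂ₖ g_{ij} + g_{kj} ∂ᵢ Xᵏ + g_{ik} ∂ⱼ Xᵏ)`. -/
def lieMetricMatrix (X : ∀ p : M, TangentSpace (𝓡 n) p) (x₀ : M)
    (y : EuclideanSpace ℝ (Fin n)) : Matrix (Fin n) (Fin n) ℝ :=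
  Matrix.of fun i j ↦ ∑ k,
    (fieldComponent X x₀ k y * metricDeriv x₀ k i j y
      + metricMatrix x₀ y k j * partialDeriv i (fieldComponent X x₀ k) y
      + metricMatrix x₀ y i k * partialDeriv j (fieldComponent X x₀ k) y)

/-- The Ricci tensor at `p`, as a bilinear form on `T_p M`. -/
def ricci (p : M) (v w : TangentSpace (𝓡 n) p) : ℝ :=
  formOfMatrix (ricciMatrix p (extChartAt (𝓡 n) p p)) p v w

/-- The Lie derivative `£_X g` at `p`, as a bilinear form on `T_p M`. -/
def lieMetric (X : ∀ p : M, TangentSpace (𝓡 n) p) (p : M) (v w : TangentSpace (𝓡 n) p) : ℝ :=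
  formOfMatrix (lieMetricMatrix X p (extChartAt (𝓡 n) p p)) p v w

/-- The scalar curvature `R = ∑ᵢⱼ gⁱʲ R_{ij}`. -/
def scalarCurvature (n : ℕ) {M : Type*} [TopologicalSpace M]
    [ChartedSpace (EuclideanSpace ℝ (Fin n)) M]
    [Bundle.RiemannianBundle (fun p : M ↦ TangentSpace (𝓡 n) p)] (p : M) : ℝ :=
  ∑ i, ∑ j, (metricMatrix p (extChartAt (𝓡 n) p p))⁻¹ i j *
    ricciMatrix p (extChartAt (𝓡 n) p p) i j

/-- The `m`-quasi Einstein equation `Ric + ½ £_X g - (1/m) X♭ ⊗ X♭ = c g` with a smooth potential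
vector field `X`, for `0 < m ≤ ∞` and a real constant `c`; here `1/∞ = 0`. -/
structure IsQuasiEinstein [IsManifold (𝓡 n) ∞ M] (m : ENNReal) (c : ℝ)
    (X : ∀ p : M, TangentSpace (𝓡 n) p) : Prop where
  pos : 0 < m
  smooth : ContMDiff (𝓡 n) (𝓡 n).tangent ∞ (fun p ↦ (⟨p, X p⟩ : TangentBundle (𝓡 n) M))
  equation : ∀ (p : M) (v w : TangentSpace (𝓡 n) p),
    ricci p v w + (1 / 2) * lieMetric X p v w - (m⁻¹).toReal * (inner ℝ (X p) v * inner ℝ (X p) w)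
      = c * inner ℝ v w

/-- The Riemannian volume measure of the domain of the chart at `x₀`, extended by zero to `M`: the
measure with density `√(det g_{ij})` with respect to Lebesgue measure in the chart. -/
def chartVolume (n : ℕ) {M : Type*} [TopologicalSpace M]
    [ChartedSpace (EuclideanSpace ℝ (Fin n)) M]
    [Bundle.RiemannianBundle (fun p : M ↦ TangentSpace (𝓡 n) p)]
    [MeasurableSpace M] (x₀ : M) : MeasureTheory.Measure M :=
  MeasureTheory.Measure.map (extChartAt (𝓡 n) x₀).symm
    ((MeasureTheory.volume.restrict (extChartAt (𝓡 n) x₀).target).withDensity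
      fun y ↦ ENNReal.ofReal (Real.sqrt (metricMatrix x₀ y).det))

/-- The Riemannian volume measure. The measures `chartVolume n x₀` agree on the overlaps of chart
domains, so their supremum is the measure on `M` that restricts to `chartVolume n x₀` on the domain
of the chart at `x₀`, for every `x₀`. -/
def riemannianVolume (n : ℕ) (M : Type*) [TopologicalSpace M]
    [ChartedSpace (EuclideanSpace ℝ (Fin n)) M]
    [Bundle.RiemannianBundle (fun p : M ↦ TangentSpace (𝓡 n) p)]
    [MeasurableSpace M] : MeasureTheory.Measure M :=
  ⨆ x₀ : M, chartVolume n x₀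

end Chart

end QuasiEinstein

end

/-!
Write `g` for the metric, `μ` for the Riemannian volume and `div X` for half the `g`-trace of the
Lie derivative `£_X g`. The trace of the quasi Einstein equation is the identity
`c n - R = div X - (1/m) |X|²` (`IsQuasiEinstein.trace`), so the theorem is about the integral of
`div X`, and the point is that the divergence contributes nothing in the limit.

*Integration by parts.* If `f` is `K`-Lipschitz with compact support, then
`|∫ f div X dμ| ≤ K ∫ |X| dμ` (`abs_integral_mul_divergence_le`). A partition of unity reduces this
to a field supported in one chart. There Voss's formula (`sqrt_det_mul_half_trace_lie`), which
follows from Jacobi's formula for the derivative of a determinant, turns `√(det g) div X` into the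
Euclidean divergence of `√(det g) X`. By Rademacher's theorem a Lipschitz function may be integrated
by parts against a compactly supported `C¹` field on `ℝⁿ` (`integral_mul_euclidean_div`), and the
differential of a `K`-Lipschitz function on `M` has Riemannian norm at most `K`
(`abs_fderiv_comp_chart_symm_le`), because the distance of nearby points is bounded by the length of
a coordinate segment.

*Independence of the chart.* Scalar curvature and divergence are computed at each point in the
preferred chart of that point, and the volume is a supremum of chart volumes. So the argument needs
that the divergence may be computed in any chart (`divergence_eq_chartDiv`), which holds because
the Lie derivative commutes with pullback (`lieForm_pullback`), and that the volume restricts to the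
chart volume on every chart domain (`riemannianVolume_restrict_source`), which is the change of
variables formula. Nothing of this kind is needed for the Ricci tensor, which enters only through
the trace at a single point; the continuity of `R` is read off from the traced equation.

*Conclusion.* By completeness closed balls are compact (`properSpace_of_complete`), so the weights
`ω_{p,r}` have compact support, and they are `1/r`-Lipschitz. Finite volume and `∫ |X|² dμ < ∞` give
`∫ |X| dμ < ∞`, hence `|∫ ω_{p,r} div X dμ| ≤ (1/r) ∫ |X| dμ → 0`, and the limit in (i) is
`-(1/m) ∫ |X|² dμ ≤ 0`. If the positive or the negative part of `c n - R` has finite integral, then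
Fatou's lemma gives the integrability of the other one and dominated convergence identifies the
integral with the limit (`integrable_and_integral_eq_of_tendsto_weighted`). If (ii) failed, then
`c n - R` would be positive on a dense set, hence nonnegative by continuity; its integral would then
be both nonnegative and nonpositive, so that `c n - R` would vanish almost everywhere and, being
continuous, everywhere.
-/

namespace QuasiEinstein

/-! ### Compactness of closed balls -/

section HopfRinow

open Metric Set Filter

/-- A complete locally compact metric space is proper as soon as it is almost geodesic: from any
point `x` one can move distance at most `r` towards `y` so as to be left with a distance that is
arbitrarily close to `dist x y - r`. -/
theorem properSpace_of_almost_geodesic {M : Type*} [MetricSpace M] [CompleteSpace M]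
    [LocallyCompactSpace M]
    (h : ∀ (x y : M) (r : ℝ), 0 ≤ r → r ≤ dist x y → ∀ ε > 0,
      ∃ z, dist x z ≤ r ∧ dist z y < dist x y - r + ε) : ProperSpace M := by
  have step : ∀ (x y : M) (r ε : ℝ), 0 ≤ r → 0 < ε → dist x y < r + ε →
      ∃ z ∈ closedBall x r, dist z y < ε := by
    intro x y r ε hr hε hxy
    by_cases hle : r ≤ dist x y
    · obtain ⟨z, hz, hzy⟩ := h x y r hr hle (r + ε - dist x y) (by linarith)
      exact ⟨z, by rwa [mem_closedBall, dist_comm], by linarith⟩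
    · exact ⟨y, by rw [mem_closedBall, dist_comm]; linarith, by simpa using hε⟩
  refine ⟨fun x R ↦ ?_⟩
  by_contra hR
  -- the radii of the compact closed balls around `x` form an interval
  set S : Set ℝ := {r | IsCompact (closedBall x r)} with hS
  have hmono : ∀ r ∈ S, ∀ s ≤ r, s ∈ S := fun r hr s hs ↦
    hr.of_isClosed_subset isClosed_closedBall (closedBall_subset_closedBall hs)
  have hbdd : BddAbove S := ⟨R, fun r hr ↦ by
    by_contra hlt
    exact hR (hmono r hr R (not_le.1 hlt).le)⟩
  have h0 : (0 : ℝ) ∈ S := by simp [hS]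
  set ρ := sSup S
  have hρ0 : 0 ≤ ρ := le_csSup hbdd h0
  have hlt : ∀ r < ρ, r ∈ S := fun r hr ↦ by
    obtain ⟨s, hs, hrs⟩ := exists_lt_of_lt_csSup ⟨0, h0⟩ hr
    exact hmono s hs r hrs.le
  -- the ball of radius `ρ` is complete, and totally bounded since it lies within distance `ε / 2`
  -- of a compact ball of slightly smaller radius
  have hρ : ρ ∈ S := by
    rcases hρ0.eq_or_lt with h' | h'
    · rwa [← h']
    refine isCompact_iff_totallyBounded_isComplete.2 ⟨?_, isClosed_closedBall.isComplete⟩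
    rw [Metric.totallyBounded_iff]
    intro ε hε
    set r := max 0 (ρ - ε / 4) with hrdef
    have hr : r < ρ := max_lt h' (by linarith)
    obtain ⟨t, ht, htc⟩ := Metric.totallyBounded_iff.1 (hlt r hr).totallyBounded (ε / 2)
      (by linarith)
    refine ⟨t, ht, fun y hy ↦ ?_⟩
    rw [mem_closedBall, dist_comm] at hy
    obtain ⟨z, hz, hzy⟩ := step x y r (ε / 2) (le_max_left _ _) (by linarith)
      (by have := le_max_right 0 (ρ - ε / 4); linarith)
    obtain ⟨w, hw, hzw⟩ := mem_iUnion₂.1 (htc hz)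
    refine mem_iUnion₂.2 ⟨w, hw, ?_⟩
    rw [mem_ball] at hzw ⊢
    calc dist y w ≤ dist z y + dist z w := dist_triangle_left _ _ _
      _ < ε := by linarith
  -- local compactness allows a radius beyond `ρ`, contrary to the choice of `ρ`
  obtain ⟨δ, hδ, hcpt⟩ := IsCompact.exists_isCompact_cthickening hρ
  have : ρ + δ / 2 ∈ S := by
    refine hcpt.of_isClosed_subset isClosed_closedBall fun y hy ↦ ?_
    rw [mem_closedBall, dist_comm] at hy
    obtain ⟨z, hz, hzy⟩ := step x y ρ δ hρ0 hδ (by linarith)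
    exact mem_cthickening_of_dist_le _ z _ _ hz (by rw [dist_comm]; exact hzy.le)
  have := le_csSup hbdd this
  linarith

/-- The distance is at most the length of a `C¹` path. -/
theorem edist_le_pathELength {n : ℕ} {M : Type*} [MetricSpace M]
    [ChartedSpace (EuclideanSpace ℝ (Fin n)) M]
    [Bundle.RiemannianBundle (fun p : M ↦ TangentSpace (𝓡 n) p)]
    [IsRiemannianManifold (𝓡 n) M] {γ : ℝ → M} {a b : ℝ} (hab : a ≤ b)
    (hγ : ContMDiffOn 𝓘(ℝ, ℝ) (𝓡 n) 1 γ (Icc a b)) :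
    edist (γ a) (γ b) ≤ Manifold.pathELength (𝓡 n) γ a b := by
  rw [IsRiemannianManifold.out (I := 𝓡 n) (γ a) (γ b)]
  exact Manifold.riemannianEDist_le_pathELength hγ rfl rfl hab

/-- A Riemannian manifold is almost geodesic: on a path from `x` to `y` of length less than
`dist x y + ε`, take a point at distance `r` from `x`. -/
theorem exists_almost_between (n : ℕ) {M : Type*} [MetricSpace M]
    [ChartedSpace (EuclideanSpace ℝ (Fin n)) M]
    [Bundle.RiemannianBundle (fun p : M ↦ TangentSpace (𝓡 n) p)]
    [IsRiemannianManifold (𝓡 n) M] (x y : M) (r : ℝ) (hr : 0 ≤ r) (hxy : r ≤ dist x y)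
    (ε : ℝ) (hε : 0 < ε) : ∃ z, dist x z ≤ r ∧ dist z y < dist x y - r + ε := by
  have h1 : Manifold.riemannianEDist (𝓡 n) x y < ENNReal.ofReal (dist x y + ε) := by
    rw [← IsRiemannianManifold.out (I := 𝓡 n) x y, edist_dist]
    exact (ENNReal.ofReal_lt_ofReal_iff (by positivity)).2 (by linarith)
  obtain ⟨γ, h0, h1, hγ, hlen⟩ := Manifold.exists_lt_of_riemannianEDist_lt h1
  have hc : ContinuousOn (fun t ↦ dist x (γ t)) (Icc 0 1) :=
    (continuous_const.dist continuous_id).comp_continuousOn hγ.continuousOn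
  obtain ⟨t, ht, htr⟩ : r ∈ (fun t ↦ dist x (γ t)) '' Icc 0 1 :=
    intermediate_value_Icc zero_le_one hc ⟨by simpa [h0] using hr, by simpa [h1] using hxy⟩
  refine ⟨γ t, htr.le, ?_⟩
  have e1 := edist_le_pathELength ht.1 (hγ.mono (Icc_subset_Icc_right ht.2))
  have e2 := edist_le_pathELength ht.2 (hγ.mono (Icc_subset_Icc_left ht.1))
  have e3 := (add_le_add e1 e2).trans_lt
    ((Manifold.pathELength_add (I := 𝓡 n) (γ := γ) ht.1 ht.2).trans_lt hlen)
  rw [h0, h1, edist_dist, edist_dist, ← ENNReal.ofReal_add dist_nonneg dist_nonneg,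
    ENNReal.ofReal_lt_ofReal_iff (by positivity)] at e3
  simp only at htr
  linarith

/-- The Hopf–Rinow theorem: closed balls of a complete Riemannian manifold are compact. -/
theorem properSpace_of_complete (n : ℕ) (M : Type*) [MetricSpace M]
    [ChartedSpace (EuclideanSpace ℝ (Fin n)) M]
    [Bundle.RiemannianBundle (fun p : M ↦ TangentSpace (𝓡 n) p)]
    [IsRiemannianManifold (𝓡 n) M] [CompleteSpace M] : ProperSpace M :=
  have : LocallyCompactSpace M := Manifold.locallyCompact_of_finiteDimensional (𝓡 n)
  properSpace_of_almost_geodesic (exists_almost_between n)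

end HopfRinow

/-! ### Derivatives of determinants and the formula of Voss -/

section Determinant

open Matrix

variable {n : ℕ}

/-- The left side is the derivative of the determinant at `A` in the direction `B`, as it arises
from multilinearity in the rows. -/
theorem sum_det_updateRow (A B : Matrix (Fin n) (Fin n) ℝ) :
    ∑ i, (A.updateRow i fun j ↦ B i j).det = (A.adjugate * B).trace := by
  rw [Matrix.trace_mul_comm]
  refine Finset.sum_congr rfl fun i _ ↦ ?_
  rw [← det_transpose, ← updateCol_transpose, ← cramer_apply, cramer_eq_adjugate_mulVec,
    ← adjugate_transpose, Matrix.diag_apply, mul_apply]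
  simp [mulVec, dotProduct, mul_comm]

/-- Jacobi's formula for the derivative of a determinant. -/
theorem fderiv_det {E : Type*} [NormedAddCommGroup E] [NormedSpace ℝ E]
    {G : E → Matrix (Fin n) (Fin n) ℝ} {y : E}
    (hG : ∀ i j, DifferentiableAt ℝ (fun z ↦ G z i j) y) (v : E) :
    HasFDerivAt (fun z ↦ (G z).det) (fderiv ℝ (fun z ↦ (G z).det) y) y ∧
    fderiv ℝ (fun z ↦ (G z).det) y v =
      ((G y).adjugate * Matrix.of fun i j ↦ fderiv ℝ (fun z ↦ G z i j) y v).trace := by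
  let D : ContinuousMultilinearMap ℝ (fun _ : Fin n ↦ Fin n → ℝ) ℝ :=
    { (detRowAlternating (n := Fin n) (R := ℝ)).toMultilinearMap with
      cont := (continuous_id : Continuous fun A : Matrix (Fin n) (Fin n) ℝ ↦ A).matrix_det }
  let G' : E →L[ℝ] (Fin n → Fin n → ℝ) :=
    ContinuousLinearMap.pi fun i ↦ ContinuousLinearMap.pi fun j ↦ fderiv ℝ (fun z ↦ G z i j) y
  have h1 : HasFDerivAt (fun z ↦ (G z : Fin n → Fin n → ℝ)) G' y :=
    hasFDerivAt_pi.2 fun i ↦ hasFDerivAt_pi.2 fun j ↦ (hG i j).hasFDerivAt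
  have h2 : HasFDerivAt (fun z ↦ (G z).det) ((D.linearDeriv (G y)).comp G') y :=
    (D.hasFDerivAt (G y)).comp y h1
  refine ⟨h2.differentiableAt.hasFDerivAt, ?_⟩
  rw [h2.fderiv, ← sum_det_updateRow]
  exact ContinuousMultilinearMap.linearDeriv_apply D (G y) (G' v)

theorem fderiv_sqrt_det {E : Type*} [NormedAddCommGroup E] [NormedSpace ℝ E]
    {G : E → Matrix (Fin n) (Fin n) ℝ} {y : E}
    (hG : ∀ i j, DifferentiableAt ℝ (fun z ↦ G z i j) y) (hpos : 0 < (G y).det) (v : E) :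
    fderiv ℝ (fun z ↦ √(G z).det) y v = √(G y).det *
      ((1 / 2) * ∑ i, ∑ j, (G y)⁻¹ i j * fderiv ℝ (fun z ↦ G z j i) y v) := by
  obtain ⟨h1, h2⟩ := fderiv_det hG v
  rw [(h1.sqrt hpos.ne').fderiv, _root_.smul_apply, h2, smul_eq_mul]
  have hs : √(G y).det * √(G y).det = (G y).det := Real.mul_self_sqrt hpos.le
  have hs0 : √(G y).det ≠ 0 := (Real.sqrt_pos.2 hpos).ne'
  have h3 : ((G y).adjugate * Matrix.of fun i j ↦ fderiv ℝ (fun z ↦ G z i j) y v).trace =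
      (G y).det * ∑ i, ∑ j, (G y)⁻¹ i j * fderiv ℝ (fun z ↦ G z j i) y v := by
    simp only [Matrix.trace, Matrix.diag_apply, mul_apply, Matrix.of_apply, Finset.mul_sum,
      Matrix.inv_def, Matrix.smul_apply, smul_eq_mul, Ring.inverse_eq_inv']
    refine Finset.sum_congr rfl fun i _ ↦ Finset.sum_congr rfl fun j _ ↦ ?_
    field_simp
  rw [h3]
  nth_rewrite 2 [← hs]
  field_simp

/-- Voss's formula: `√det G` times the divergence, computed as half the `G`-trace of the Lie
derivative of `G`, is the Euclidean divergence of `√det G • V`. -/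
theorem sqrt_det_mul_half_trace_lie {G : EuclideanSpace ℝ (Fin n) → Matrix (Fin n) (Fin n) ℝ}
    {V : Fin n → EuclideanSpace ℝ (Fin n) → ℝ} {y : EuclideanSpace ℝ (Fin n)}
    (hG : ∀ i j, DifferentiableAt ℝ (fun z ↦ G z i j) y)
    (hV : ∀ k, DifferentiableAt ℝ (V k) y) (hsymm : ∀ z i j, G z i j = G z j i)
    (hpos : 0 < (G y).det) :
    √(G y).det * ((1 / 2) * ∑ i, ∑ j, (G y)⁻¹ i j * ∑ k,
      (V k y * partialDeriv k (fun z ↦ G z i j) y + G y k j * partialDeriv i (V k) y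
        + G y i k * partialDeriv j (V k) y)) =
      ∑ k, partialDeriv k (fun z ↦ √(G z).det * V k z) y := by
  have hdet : DifferentiableAt ℝ (fun z ↦ √(G z).det) y :=
    ((fderiv_det hG 0).1.sqrt hpos.ne').differentiableAt
  have hu : IsUnit (G y).det := hpos.ne'.isUnit
  have hinv1 : ∀ i k, ∑ j, (G y)⁻¹ i j * G y j k = if i = k then 1 else 0 := fun i k ↦ by
    rw [← mul_apply, nonsing_inv_mul _ hu, Matrix.one_apply]
  have hinv2 : ∀ j k, ∑ i, G y k i * (G y)⁻¹ i j = if k = j then 1 else 0 := fun j k ↦ by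
    rw [← mul_apply, mul_nonsing_inv _ hu, Matrix.one_apply]
  have e1 : ∀ k, partialDeriv k (fun z ↦ √(G z).det * V k z) y =
      √(G y).det * (partialDeriv k (V k) y + V k y *
        ((1 / 2) * ∑ i, ∑ j, (G y)⁻¹ i j * partialDeriv k (fun z ↦ G z i j) y)) := fun k ↦ by
    have := fderiv_sqrt_det hG hpos (unitVec k)
    simp only [partialDeriv]
    rw [fderiv_fun_mul hdet (hV k)]
    simp only [_root_.add_apply, _root_.smul_apply, smul_eq_mul]
    rw [this]
    simp only [fun i j ↦ funext fun z ↦ hsymm z j i]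
    ring
  have e2 : ∑ i, ∑ j, (G y)⁻¹ i j * ∑ k, G y k j * partialDeriv i (V k) y =
      ∑ k, partialDeriv k (V k) y := by
    refine Finset.sum_congr rfl fun i _ ↦ ?_
    simp_rw [Finset.mul_sum, ← mul_assoc]
    rw [Finset.sum_comm]
    have : ∀ k, ∑ j, (G y)⁻¹ i j * G y k j = if i = k then 1 else 0 := fun k ↦ by
      rw [← hinv1 i k]; exact Finset.sum_congr rfl fun j _ ↦ by rw [hsymm y k j]
    simp_rw [← Finset.sum_mul, this]
    simp
  have e3 : ∑ i, ∑ j, (G y)⁻¹ i j * ∑ k, G y i k * partialDeriv j (V k) y =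
      ∑ k, partialDeriv k (V k) y := by
    rw [Finset.sum_comm]
    refine Finset.sum_congr rfl fun j _ ↦ ?_
    simp_rw [Finset.mul_sum, ← mul_assoc]
    rw [Finset.sum_comm]
    have : ∀ k, ∑ i, (G y)⁻¹ i j * G y i k = if k = j then 1 else 0 := fun k ↦ by
      rw [← hinv2 j k]
      exact Finset.sum_congr rfl fun i _ ↦ by rw [hsymm y i k, mul_comm]
    simp_rw [← Finset.sum_mul, this]
    simp
  have e4 : ∑ i, ∑ j, (G y)⁻¹ i j * ∑ k, V k y * partialDeriv k (fun z ↦ G z i j) y =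
      ∑ k, V k y * ∑ i, ∑ j, (G y)⁻¹ i j * partialDeriv k (fun z ↦ G z i j) y := by
    simp_rw [Finset.mul_sum]
    rw [Finset.sum_comm_cycle]
    refine Finset.sum_congr rfl fun k _ ↦ Finset.sum_congr rfl fun i _ ↦
      Finset.sum_congr rfl fun j _ ↦ by ring
  simp_rw [e1, ← Finset.mul_sum, Finset.sum_add_distrib, mul_add, Finset.sum_add_distrib]
  rw [e2, e3, e4, ← mul_add]
  congr 1
  simp_rw [mul_left_comm _ (1 / 2 : ℝ), ← Finset.mul_sum]
  ring

end Determinant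

/-! ### Lie derivatives and changes of coordinates -/

noncomputable section Lie

open Matrix

variable {E : Type*} [NormedAddCommGroup E] [NormedSpace ℝ E]

/-- The Lie derivative of a field `h` of bilinear forms on a vector space along the vector field
`V`. -/
def lieForm (h : E → E →L[ℝ] E →L[ℝ] ℝ) (V : E → E) (y v w : E) : ℝ :=
  fderiv ℝ h y (V y) v w + h y (fderiv ℝ V y v) w + h y v (fderiv ℝ V y w)

set_option synthInstance.maxHeartbeats 200000 in
/-- The Lie derivative of a field of bilinear forms commutes with pullback under a change of
coordinates `ψ`. The second derivatives of `ψ` cancel by symmetry. -/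
theorem lieForm_pullback {h h' : E → E →L[ℝ] E →L[ℝ] ℝ} {V V' : E → E} {ψ : E → E} {y : E}
    (hψ : ContDiffAt ℝ 2 ψ y) (hh : DifferentiableAt ℝ h (ψ y)) (hh' : DifferentiableAt ℝ h' y)
    (hV : DifferentiableAt ℝ V (ψ y)) (hV' : DifferentiableAt ℝ V' y)
    (e : ∀ᶠ z in 𝓝 y, ∀ v w, h' z v w = h (ψ z) (fderiv ℝ ψ z v) (fderiv ℝ ψ z w))
    (eV : ∀ᶠ z in 𝓝 y, V (ψ z) = fderiv ℝ ψ z (V' z)) (v w : E) :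
    lieForm h' V' y v w = lieForm h V (ψ y) (fderiv ℝ ψ y v) (fderiv ℝ ψ y w) := by
  have hd : HasFDerivAt ψ (fderiv ℝ ψ y) y := (hψ.differentiableAt (by simp)).hasFDerivAt
  have hJ : HasFDerivAt (fderiv ℝ ψ) (fderiv ℝ (fderiv ℝ ψ) y) y :=
    ((hψ.fderiv_right (m := 1) (by norm_num)).differentiableAt (by simp)).hasFDerivAt
  have hsymm : ∀ a b, fderiv ℝ (fderiv ℝ ψ) y a b = fderiv ℝ (fderiv ℝ ψ) y b a := fun a b ↦
    (hψ.isSymmSndFDerivAt (by simp)) a b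
  have hJv : ∀ v, HasFDerivAt (fun z ↦ fderiv ℝ ψ z v)
      ((fderiv ℝ (fderiv ℝ ψ) y).flip v) y := fun v ↦ by
    have := hJ.clm_apply (hasFDerivAt_const v y)
    convert this using 1
    ext; simp
  have hhψ : HasFDerivAt (fun z ↦ h (ψ z)) ((fderiv ℝ h (ψ y)).comp (fderiv ℝ ψ y)) y :=
    HasFDerivAt.comp (g := h) (f := ψ) y hh.hasFDerivAt hd
  have d1 : ∀ u, fderiv ℝ h' y u v w =
      fderiv ℝ h (ψ y) (fderiv ℝ ψ y u) (fderiv ℝ ψ y v) (fderiv ℝ ψ y w)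
      + h (ψ y) (fderiv ℝ (fderiv ℝ ψ) y u v) (fderiv ℝ ψ y w)
      + h (ψ y) (fderiv ℝ ψ y v) (fderiv ℝ (fderiv ℝ ψ) y u w) := fun u ↦ by
    have h1 := ((hhψ.clm_apply (hJv v)).clm_apply (hJv w)).congr_of_eventuallyEq
      (f₁ := fun z ↦ h' z v w) (e.mono fun z hz ↦ hz v w)
    have h2 := (hh'.hasFDerivAt.clm_apply (hasFDerivAt_const v y)).clm_apply
      (hasFDerivAt_const w y)
    have := congrArg (fun L : E →L[ℝ] ℝ ↦ L u) (h2.unique h1)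
    simp at this
    rw [this]; ring
  have d2 : ∀ u, fderiv ℝ V (ψ y) (fderiv ℝ ψ y u) =
      fderiv ℝ (fderiv ℝ ψ) y u (V' y) + fderiv ℝ ψ y (fderiv ℝ V' y u) := fun u ↦ by
    have h1 := (hJ.clm_apply hV'.hasFDerivAt).congr_of_eventuallyEq
      (f₁ := fun z ↦ V (ψ z)) (eV.mono fun z hz ↦ hz)
    have h2 := hV.hasFDerivAt.comp y hd
    have := congrArg (fun L : E →L[ℝ] E ↦ L u) (HasFDerivAt.unique h2 h1)
    simp at this
    rw [this, add_comm]
  have e0 := e.self_of_nhds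
  simp only [lieForm, d1, d2, e0, map_add, _root_.add_apply, eV.self_of_nhds,
    hsymm _ (V' y)]
  ring

/-- The trace of a bilinear form with respect to a metric does not depend on the basis. -/
theorem trace_congruence {n : ℕ} (G L J : Matrix (Fin n) (Fin n) ℝ) (hJ : IsUnit J.det) :
    ((Jᵀ * G * J)⁻¹ * (Jᵀ * L * J)).trace = (G⁻¹ * L).trace := by
  have hJt : IsUnit Jᵀ.det := by rwa [det_transpose]
  rw [Matrix.mul_inv_rev, Matrix.mul_inv_rev]
  have : J⁻¹ * (G⁻¹ * Jᵀ⁻¹) * (Jᵀ * L * J) = J⁻¹ * (G⁻¹ * L * J) := by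
    simp only [Matrix.mul_assoc]
    rw [← Matrix.mul_assoc Jᵀ⁻¹, nonsing_inv_mul _ hJt, Matrix.one_mul]
  rw [this, Matrix.trace_mul_comm, Matrix.mul_assoc, mul_nonsing_inv _ hJ, Matrix.mul_one]

end Lie

/-! ### Vector fields and the metric in a chart -/

noncomputable section ChartGeometry

open Set

variable {n : ℕ} {M : Type*} [TopologicalSpace M] [ChartedSpace (EuclideanSpace ℝ (Fin n)) M]

/-- The differential at `y` of the inverse of the chart at `x₀`, regarded as an endomorphism of
`ℝⁿ`, which is the underlying vector space of every tangent space. -/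
def frame (x₀ : M) (y : EuclideanSpace ℝ (Fin n)) :
    EuclideanSpace ℝ (Fin n) →L[ℝ] EuclideanSpace ℝ (Fin n) :=
  mfderiv 𝓘(ℝ, EuclideanSpace ℝ (Fin n)) (𝓡 n) (extChartAt (𝓡 n) x₀).symm y

/-- The differential at `p` of the chart at `x₀`, regarded as an endomorphism of `ℝⁿ`. -/
def coframe (x₀ p : M) : EuclideanSpace ℝ (Fin n) →L[ℝ] EuclideanSpace ℝ (Fin n) :=
  mfderiv (𝓡 n) 𝓘(ℝ, EuclideanSpace ℝ (Fin n)) (extChartAt (𝓡 n) x₀) p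

/-- The representative in the chart at `x₀` of a vector field. -/
def localField (X : ∀ p : M, TangentSpace (𝓡 n) p) (x₀ : M) (y : EuclideanSpace ℝ (Fin n)) :
    EuclideanSpace ℝ (Fin n) :=
  coframe x₀ ((extChartAt (𝓡 n) x₀).symm y) (X ((extChartAt (𝓡 n) x₀).symm y))

theorem sum_unitVec (v : EuclideanSpace ℝ (Fin n)) : ∑ i, v i • unitVec i = v := by
  ext j
  simp [unitVec, Pi.single_apply]

section

variable [IsManifold (𝓡 n) ∞ M]

theorem mdifferentiableAt_chart_symm {x₀ : M} {y : EuclideanSpace ℝ (Fin n)}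
    (hy : y ∈ (extChartAt (𝓡 n) x₀).target) :
    MDifferentiableAt 𝓘(ℝ, EuclideanSpace ℝ (Fin n)) (𝓡 n) (extChartAt (𝓡 n) x₀).symm y := by
  have := mdifferentiableWithinAt_extChartAt_symm (I := 𝓡 n) hy
  rwa [ModelWithCorners.range_eq_univ, mdifferentiableWithinAt_univ] at this

theorem coframe_frame {x₀ : M} {y : EuclideanSpace ℝ (Fin n)}
    (hy : y ∈ (extChartAt (𝓡 n) x₀).target) (v : EuclideanSpace ℝ (Fin n)) :
    coframe x₀ ((extChartAt (𝓡 n) x₀).symm y) (frame x₀ y v) = v := by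
  have := mfderiv_extChartAt_comp_mfderivWithin_extChartAt_symm (I := 𝓡 n) hy
  rw [ModelWithCorners.range_eq_univ, mfderivWithin_univ] at this
  exact congrArg (fun L : EuclideanSpace ℝ (Fin n) →L[ℝ] EuclideanSpace ℝ (Fin n) ↦ L v) this

theorem frame_coframe {x₀ : M} {y : EuclideanSpace ℝ (Fin n)}
    (hy : y ∈ (extChartAt (𝓡 n) x₀).target) (v : EuclideanSpace ℝ (Fin n)) :
    frame x₀ y (coframe x₀ ((extChartAt (𝓡 n) x₀).symm y) v) = v := by
  have := mfderivWithin_extChartAt_symm_comp_mfderiv_extChartAt (I := 𝓡 n) hy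
  rw [ModelWithCorners.range_eq_univ, mfderivWithin_univ] at this
  exact congrArg (fun L : EuclideanSpace ℝ (Fin n) →L[ℝ] EuclideanSpace ℝ (Fin n) ↦ L v) this

theorem frame_localField (X : ∀ p : M, TangentSpace (𝓡 n) p) {x₀ : M}
    {y : EuclideanSpace ℝ (Fin n)} (hy : y ∈ (extChartAt (𝓡 n) x₀).target) :
    frame x₀ y (localField X x₀ y) = X ((extChartAt (𝓡 n) x₀).symm y) :=
  frame_coframe hy _

theorem contDiffOn_localField {X : ∀ p : M, TangentSpace (𝓡 n) p}
    (hX : ContMDiff (𝓡 n) (𝓡 n).tangent ∞ (fun p ↦ (⟨p, X p⟩ : TangentBundle (𝓡 n) M)))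
    (x₀ : M) : ContDiffOn ℝ ∞ (localField X x₀) (extChartAt (𝓡 n) x₀).target := by
  have h1 : ContMDiffOn (𝓡 n).tangent 𝓘(ℝ, EuclideanSpace ℝ (Fin n)).tangent ∞
      (tangentMapWithin (𝓡 n) 𝓘(ℝ, EuclideanSpace ℝ (Fin n)) (extChartAt (𝓡 n) x₀)
        (extChartAt (𝓡 n) x₀).source)
      (Bundle.TotalSpace.proj ⁻¹' (extChartAt (𝓡 n) x₀).source) := by
    refine ContMDiffOn.contMDiffOn_tangentMapWithin (n := ∞) ?_ (by simp)
      (isOpen_extChartAt_source x₀).uniqueMDiffOn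
    rw [extChartAt_source]
    exact contMDiffOn_extChartAt
  have h2 := (contMDiff_snd_tangentBundle_modelSpace (EuclideanSpace ℝ (Fin n))
    𝓘(ℝ, EuclideanSpace ℝ (Fin n)) (n := ∞)).comp_contMDiffOn (h1.comp hX.contMDiffOn
      (s := (extChartAt (𝓡 n) x₀).source) (fun p hp ↦ hp))
  have h3 := h2.comp (contMDiffOn_extChartAt_symm (I := 𝓡 n) (n := ∞) x₀)
    (fun y hy ↦ (extChartAt (𝓡 n) x₀).map_target hy)
  refine (contMDiffOn_iff_contDiffOn.1 h3).congr fun y hy ↦ ?_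
  have hs := (extChartAt (𝓡 n) x₀).map_target hy
  have e := mfderivWithin_of_isOpen (I := 𝓡 n) (I' := 𝓘(ℝ, EuclideanSpace ℝ (Fin n)))
    (f := extChartAt (𝓡 n) x₀) (isOpen_extChartAt_source x₀) hs
  exact congrArg (fun L : EuclideanSpace ℝ (Fin n) →L[ℝ] EuclideanSpace ℝ (Fin n) ↦
    L (X ((extChartAt (𝓡 n) x₀).symm y))) e.symm

theorem differentiableAt_localField
    {X : ∀ p : M, TangentSpace (𝓡 n) p}
    (hX : ContMDiff (𝓡 n) (𝓡 n).tangent ∞ (fun p ↦ (⟨p, X p⟩ : TangentBundle (𝓡 n) M)))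
    {x₀ : M} {y : EuclideanSpace ℝ (Fin n)} (hy : y ∈ (extChartAt (𝓡 n) x₀).target) :
    DifferentiableAt ℝ (localField X x₀) y :=
  ((contDiffOn_localField hX x₀).contDiffAt
    ((isOpen_extChartAt_target x₀).mem_nhds hy)).differentiableAt (by simp)

variable (n M) in
/-- `y ↦ (φ⁻¹ y, dφ⁻¹ v)` is a smooth map to the tangent bundle, for each fixed `v`. -/
theorem contMDiffOn_frame (x₀ : M) (v : EuclideanSpace ℝ (Fin n)) :
    ContMDiffOn 𝓘(ℝ, EuclideanSpace ℝ (Fin n)) (𝓡 n).tangent ∞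
      (fun y ↦ (⟨(extChartAt (𝓡 n) x₀).symm y, frame x₀ y v⟩ : TangentBundle (𝓡 n) M))
      (extChartAt (𝓡 n) x₀).target := by
  have h1 := ContMDiffOn.contMDiffOn_tangentMapWithin (n := ∞) (m := ∞)
    (contMDiffOn_extChartAt_symm (I := 𝓡 n) x₀) (by simp)
    (isOpen_extChartAt_target x₀).uniqueMDiffOn
  have h2 : ContMDiff 𝓘(ℝ, EuclideanSpace ℝ (Fin n)) 𝓘(ℝ, EuclideanSpace ℝ (Fin n)).tangent ∞
      (fun y ↦ (⟨y, v⟩ : TangentBundle 𝓘(ℝ, EuclideanSpace ℝ (Fin n))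
        (EuclideanSpace ℝ (Fin n)))) := by
    intro y
    exact (contMDiffAt_vectorSpace_iff_contDiffAt (V := fun _ ↦ v)).2 contDiffAt_const
  refine (h1.comp h2.contMDiffOn (s := (extChartAt (𝓡 n) x₀).target) (fun p hp ↦ hp)).congr
    fun y hy ↦ ?_
  have e := mfderivWithin_of_isOpen (I := 𝓘(ℝ, EuclideanSpace ℝ (Fin n))) (I' := 𝓡 n)
    (f := (extChartAt (𝓡 n) x₀).symm) (isOpen_extChartAt_target x₀) hy
  exact congrArg (fun L : EuclideanSpace ℝ (Fin n) →L[ℝ] EuclideanSpace ℝ (Fin n) ↦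
    (⟨(extChartAt (𝓡 n) x₀).symm y, L v⟩ : TangentBundle (𝓡 n) M)) e.symm

end

variable [Bundle.RiemannianBundle (fun p : M ↦ TangentSpace (𝓡 n) p)]

/-- The Riemannian metric at `p`, as a bilinear map on `ℝⁿ`, the underlying vector space of
`T_p M`. -/
def metricAt (p : M) (v w : EuclideanSpace ℝ (Fin n)) : ℝ :=
  inner (E := TangentSpace (𝓡 n) p) ℝ v w

theorem metricAt_comm (p : M) (v w : EuclideanSpace ℝ (Fin n)) :
    metricAt p v w = metricAt p w v :=
  real_inner_comm (F := TangentSpace (𝓡 n) p) w v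

theorem metricAt_self_nonneg (p : M) (v : EuclideanSpace ℝ (Fin n)) : 0 ≤ metricAt p v v :=
  real_inner_self_nonneg (F := TangentSpace (𝓡 n) p) (x := v)

theorem metricAt_self_pos (p : M) {v : EuclideanSpace ℝ (Fin n)} (hv : v ≠ 0) :
    0 < metricAt p v v :=
  real_inner_self_pos (F := TangentSpace (𝓡 n) p) (x := v).2 hv

theorem metricAt_sum_left {ι : Type*} (p : M) (s : Finset ι) (f : ι → EuclideanSpace ℝ (Fin n))
    (w : EuclideanSpace ℝ (Fin n)) :
    metricAt p (∑ i ∈ s, f i) w = ∑ i ∈ s, metricAt p (f i) w :=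
  sum_inner (𝕜 := ℝ) (E := TangentSpace (𝓡 n) p) s f w

theorem metricAt_sum_right {ι : Type*} (p : M) (s : Finset ι) (f : ι → EuclideanSpace ℝ (Fin n))
    (w : EuclideanSpace ℝ (Fin n)) :
    metricAt p w (∑ i ∈ s, f i) = ∑ i ∈ s, metricAt p w (f i) :=
  inner_sum (𝕜 := ℝ) (E := TangentSpace (𝓡 n) p) s f w

theorem metricAt_smul_left (p : M) (a : ℝ) (v w : EuclideanSpace ℝ (Fin n)) :
    metricAt p (a • v) w = a * metricAt p v w :=
  real_inner_smul_left (F := TangentSpace (𝓡 n) p) v w a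

theorem metricAt_smul_right (p : M) (a : ℝ) (v w : EuclideanSpace ℝ (Fin n)) :
    metricAt p v (a • w) = a * metricAt p v w :=
  real_inner_smul_right (F := TangentSpace (𝓡 n) p) v w a

theorem metricMatrix_eq (x₀ : M) (y : EuclideanSpace ℝ (Fin n)) (i j : Fin n) :
    metricMatrix x₀ y i j = metricAt ((extChartAt (𝓡 n) x₀).symm y) (frame x₀ y (unitVec i))
      (frame x₀ y (unitVec j)) := rfl

theorem metricMatrix_symm (x₀ : M) (y : EuclideanSpace ℝ (Fin n)) (i j : Fin n) :
    metricMatrix x₀ y i j = metricMatrix x₀ y j i :=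
  metricAt_comm _ _ _

/-- The metric on two vectors given by their components in the chart at `x₀`. -/
theorem metricAt_frame (x₀ : M) (y v w : EuclideanSpace ℝ (Fin n)) :
    metricAt ((extChartAt (𝓡 n) x₀).symm y) (frame x₀ y v) (frame x₀ y w) =
      ∑ i, ∑ j, metricMatrix x₀ y i j * v i * w j := by
  conv_lhs => rw [← sum_unitVec v, ← sum_unitVec w]
  simp only [map_sum, map_smul, metricAt_sum_left, metricAt_sum_right, metricAt_smul_left,
    metricAt_smul_right, metricMatrix_eq]
  simp only [Finset.mul_sum]
  rw [Finset.sum_comm]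
  refine Finset.sum_congr rfl fun i _ ↦ Finset.sum_congr rfl fun j _ ↦ by ring

variable [IsManifold (𝓡 n) ∞ M]

theorem posDef_metricMatrix {x₀ : M} {y : EuclideanSpace ℝ (Fin n)}
    (hy : y ∈ (extChartAt (𝓡 n) x₀).target) : (metricMatrix x₀ y).PosDef := by
  refine Matrix.PosDef.of_dotProduct_mulVec_pos
    (Matrix.IsHermitian.ext fun i j ↦ metricMatrix_symm x₀ y j i) fun v hv ↦ ?_
  have hv' : frame x₀ y (WithLp.toLp 2 v) ≠ 0 := fun h0 ↦ hv <| by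
    have := coframe_frame hy (WithLp.toLp 2 v)
    rw [h0, map_zero] at this
    simpa using this.symm
  have h1 := metricAt_self_pos ((extChartAt (𝓡 n) x₀).symm y) hv'
  rw [metricAt_frame] at h1
  refine h1.trans_eq ?_
  simp only [dotProduct, Matrix.mulVec, Finset.mul_sum, star_trivial]
  refine Finset.sum_congr rfl fun i _ ↦ Finset.sum_congr rfl fun j _ ↦ by ring

theorem det_metricMatrix_pos {x₀ : M} {y : EuclideanSpace ℝ (Fin n)}
    (hy : y ∈ (extChartAt (𝓡 n) x₀).target) : 0 < (metricMatrix x₀ y).det :=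
  (posDef_metricMatrix hy).det_pos

variable [IsContMDiffRiemannianBundle (𝓡 n) ∞ (EuclideanSpace ℝ (Fin n))
    (fun p : M ↦ TangentSpace (𝓡 n) p)]

theorem contDiffOn_metricMatrix (x₀ : M) (i j : Fin n) :
    ContDiffOn ℝ ∞ (fun y ↦ metricMatrix x₀ y i j) (extChartAt (𝓡 n) x₀).target := by
  have h := ContMDiffOn.inner_bundle (IB := 𝓡 n) (F := EuclideanSpace ℝ (Fin n))
    (E := fun p : M ↦ TangentSpace (𝓡 n) p) (contMDiffOn_frame n M x₀ (unitVec i))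
    (contMDiffOn_frame n M x₀ (unitVec j))
  exact contMDiffOn_iff_contDiffOn.1 h

theorem contDiffOn_sqrt_det (x₀ : M) :
    ContDiffOn ℝ ∞ (fun y ↦ √(metricMatrix x₀ y).det) (extChartAt (𝓡 n) x₀).target := by
  have h : ContDiffOn ℝ ∞ (fun y ↦ (metricMatrix x₀ y).det) (extChartAt (𝓡 n) x₀).target := by
    simp only [Matrix.det_apply]
    exact ContDiffOn.sum fun σ _ ↦ ContDiffOn.const_smul _
      (contDiffOn_prod fun i _ ↦ contDiffOn_metricMatrix x₀ _ _)
  exact h.sqrt fun y hy ↦ (det_metricMatrix_pos hy).ne'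

open MeasureTheory in
theorem aemeasurable_density (x₀ : M) :
    AEMeasurable (fun y ↦ ENNReal.ofReal √(metricMatrix x₀ y).det)
      (volume.restrict (extChartAt (𝓡 n) x₀).target) :=
  ((contDiffOn_sqrt_det x₀).continuousOn.aemeasurable
    (isOpen_extChartAt_target x₀).measurableSet).ennreal_ofReal

end ChartGeometry

/-! ### Transition maps -/

noncomputable section Transition

open Set Filter

variable {n : ℕ} {M : Type*} [TopologicalSpace M] [ChartedSpace (EuclideanSpace ℝ (Fin n)) M]

/-- The change of coordinates from the chart at `x₁` to the chart at `x₀`. -/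
def transition (x₁ x₀ : M) (y : EuclideanSpace ℝ (Fin n)) : EuclideanSpace ℝ (Fin n) :=
  extChartAt (𝓡 n) x₀ ((extChartAt (𝓡 n) x₁).symm y)

/-- The part of the target of the chart at `x₁` that is covered by the chart at `x₀`. -/
def overlap (x₁ x₀ : M) : Set (EuclideanSpace ℝ (Fin n)) :=
  (extChartAt (𝓡 n) x₁).target ∩ (extChartAt (𝓡 n) x₁).symm ⁻¹' (extChartAt (𝓡 n) x₀).source

theorem isOpen_overlap (x₁ x₀ : M) : IsOpen (overlap (n := n) x₁ x₀) :=
  (continuousOn_extChartAt_symm x₁).isOpen_inter_preimage (isOpen_extChartAt_target x₁)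
    (isOpen_extChartAt_source x₀)

variable {x₁ x₀ : M} {y : EuclideanSpace ℝ (Fin n)}

theorem transition_mem_target (hy : y ∈ overlap x₁ x₀) :
    transition x₁ x₀ y ∈ (extChartAt (𝓡 n) x₀).target :=
  (extChartAt (𝓡 n) x₀).map_source hy.2

theorem chart_symm_transition (hy : y ∈ overlap x₁ x₀) :
    (extChartAt (𝓡 n) x₀).symm (transition x₁ x₀ y) = (extChartAt (𝓡 n) x₁).symm y :=
  (extChartAt (𝓡 n) x₀).left_inv hy.2

theorem transition_mem_overlap (hy : y ∈ overlap x₁ x₀) :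
    transition x₁ x₀ y ∈ overlap x₀ x₁ :=
  ⟨transition_mem_target hy, by
    rw [mem_preimage, chart_symm_transition hy]; exact (extChartAt (𝓡 n) x₁).map_target hy.1⟩

theorem transition_transition (hy : y ∈ overlap x₁ x₀) :
    transition x₀ x₁ (transition x₁ x₀ y) = y := by
  rw [transition, chart_symm_transition hy]
  exact (extChartAt (𝓡 n) x₁).right_inv hy.1

theorem injOn_transition (x₁ x₀ : M) : InjOn (transition x₁ x₀) (overlap (n := n) x₁ x₀) :=
  fun a ha b hb h ↦ by rw [← transition_transition ha, h, transition_transition hb]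

section

variable [IsManifold (𝓡 n) ∞ M]

theorem contDiffAt_transition (hy : y ∈ overlap x₁ x₀) :
    ContDiffAt ℝ ∞ (transition x₁ x₀) y := by
  have := contDiffWithinAt_ext_coord_change (I := 𝓡 n) (n := ∞) x₀ x₁ (y := y)
    (by rw [PartialEquiv.trans_source]; exact hy)
  rw [ModelWithCorners.range_eq_univ] at this
  exact this.contDiffAt univ_mem

theorem frame_transition (hy : y ∈ overlap x₁ x₀) (v : EuclideanSpace ℝ (Fin n)) :
    frame x₀ (transition x₁ x₀ y) (fderiv ℝ (transition x₁ x₀) y v) = frame x₁ y v := by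
  have hd : HasMFDerivAt 𝓘(ℝ, EuclideanSpace ℝ (Fin n)) 𝓘(ℝ, EuclideanSpace ℝ (Fin n))
      (transition x₁ x₀) y (fderiv ℝ (transition x₁ x₀) y) :=
    ((contDiffAt_transition hy).differentiableAt (by simp)).hasFDerivAt.hasMFDerivAt
  have h0 := (mdifferentiableAt_chart_symm (transition_mem_target hy)).hasMFDerivAt
  have h1 := h0.comp y hd
  have h2 : (extChartAt (𝓡 n) x₁).symm =ᶠ[𝓝 y] (extChartAt (𝓡 n) x₀).symm ∘ transition x₁ x₀ :=
    ((isOpen_overlap x₁ x₀).eventually_mem hy).mono fun z hz ↦ (chart_symm_transition hz).symm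
  have h3 := (h1.congr_of_eventuallyEq h2).mfderiv
  exact (congrArg (fun L : EuclideanSpace ℝ (Fin n) →L[ℝ] EuclideanSpace ℝ (Fin n) ↦ L v) h3).symm

theorem fderiv_transition_injective (hy : y ∈ overlap x₁ x₀) :
    Function.Injective (fderiv ℝ (transition x₁ x₀) y) := fun v w h ↦ by
  rw [← coframe_frame hy.1 v, ← frame_transition hy v, h, frame_transition hy w,
    coframe_frame hy.1 w]

theorem localField_transition (X : ∀ p : M, TangentSpace (𝓡 n) p) (hy : y ∈ overlap x₁ x₀) :
    localField X x₀ (transition x₁ x₀ y) =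
      fderiv ℝ (transition x₁ x₀) y (localField X x₁ y) := by
  have h1 := frame_localField X (transition_mem_target hy)
  have h2 := frame_localField X hy.1
  have h3 := congrArg (fun p ↦ (X p : EuclideanSpace ℝ (Fin n))) (chart_symm_transition hy)
  rw [← frame_transition hy] at h2
  have h4 : frame x₀ (transition x₁ x₀ y) (localField X x₀ (transition x₁ x₀ y)) =
    frame x₀ (transition x₁ x₀ y) (fderiv ℝ (transition x₁ x₀) y (localField X x₁ y)) :=
    h1.trans (h3.trans h2.symm)
  rw [← coframe_frame (transition_mem_target hy) (localField X x₀ (transition x₁ x₀ y)), h4,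
    coframe_frame (transition_mem_target hy)]

end

/-- The Jacobi matrix of a change of coordinates. -/
def jacobiMatrix (x₁ x₀ : M) (y : EuclideanSpace ℝ (Fin n)) : Matrix (Fin n) (Fin n) ℝ :=
  Matrix.of fun a i ↦ fderiv ℝ (transition x₁ x₀) y (unitVec i) a

theorem det_jacobiMatrix (x₁ x₀ : M) (y : EuclideanSpace ℝ (Fin n)) :
    (jacobiMatrix x₁ x₀ y).det = (fderiv ℝ (transition x₁ x₀) y).det := by
  rw [ContinuousLinearMap.det, ← LinearMap.det_toMatrix (EuclideanSpace.basisFun (Fin n) ℝ).toBasis]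
  congr 1

theorem det_jacobiMatrix_ne_zero [IsManifold (𝓡 n) ∞ M] (hy : y ∈ overlap x₁ x₀) :
    (jacobiMatrix x₁ x₀ y).det ≠ 0 := by
  rw [det_jacobiMatrix]
  have h := fderiv_transition_injective hy
  exact (LinearEquiv.isUnit_det' (LinearEquiv.ofInjectiveEndo
    (fderiv ℝ (transition x₁ x₀) y : EuclideanSpace ℝ (Fin n) →ₗ[ℝ] EuclideanSpace ℝ (Fin n))
      h)).ne_zero

open Matrix in
theorem eq_congruence {A A' J : Matrix (Fin n) (Fin n) ℝ}
    (h : ∀ i j, A' i j = ∑ a, ∑ b, A a b * J a i * J b j) : A' = Jᵀ * A * J := by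
  ext i j
  rw [h, Matrix.mul_apply]
  simp only [Matrix.mul_apply, Matrix.transpose_apply, Finset.sum_mul]
  rw [Finset.sum_comm]
  refine Finset.sum_congr rfl fun a _ ↦ Finset.sum_congr rfl fun b _ ↦ by ring

variable [Bundle.RiemannianBundle (fun p : M ↦ TangentSpace (𝓡 n) p)]

theorem metricMatrix_transition [IsManifold (𝓡 n) ∞ M] (hy : y ∈ overlap x₁ x₀) :
    metricMatrix x₁ y = (jacobiMatrix x₁ x₀ y).transpose * metricMatrix x₀ (transition x₁ x₀ y) *
      jacobiMatrix x₁ x₀ y := by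
  refine eq_congruence fun i j ↦ ?_
  rw [metricMatrix_eq, ← frame_transition hy, ← frame_transition hy, ← chart_symm_transition hy,
    metricAt_frame]
  rfl

theorem sqrt_det_transition [IsManifold (𝓡 n) ∞ M] (hy : y ∈ overlap x₁ x₀) :
    √(metricMatrix x₁ y).det =
      |(fderiv ℝ (transition x₁ x₀) y).det| * √(metricMatrix x₀ (transition x₁ x₀ y)).det := by
  rw [metricMatrix_transition hy, Matrix.det_mul, Matrix.det_mul, Matrix.det_transpose,
    ← det_jacobiMatrix, mul_right_comm, Real.sqrt_mul (mul_self_nonneg _),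
    Real.sqrt_mul_self_eq_abs]

/-- The bilinear form `(v, w) ↦ vⁱ wʲ` on `ℝⁿ`. -/
def coordForm (i j : Fin n) :
    EuclideanSpace ℝ (Fin n) →L[ℝ] EuclideanSpace ℝ (Fin n) →L[ℝ] ℝ :=
  (EuclideanSpace.proj i : EuclideanSpace ℝ (Fin n) →L[ℝ] ℝ).smulRight
    (EuclideanSpace.proj j : EuclideanSpace ℝ (Fin n) →L[ℝ] ℝ)

/-- The metric in the chart at `x₀`, as a field of bilinear forms on `ℝⁿ`. -/
def metricForm (x₀ : M) (y : EuclideanSpace ℝ (Fin n)) :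
    EuclideanSpace ℝ (Fin n) →L[ℝ] EuclideanSpace ℝ (Fin n) →L[ℝ] ℝ :=
  ∑ i, ∑ j, metricMatrix x₀ y i j • coordForm i j

theorem metricForm_apply (x₀ : M) (y v w : EuclideanSpace ℝ (Fin n)) :
    metricForm x₀ y v w = ∑ i, ∑ j, metricMatrix x₀ y i j * v i * w j := by
  simp [metricForm, coordForm, mul_assoc]

theorem metricForm_eq_metricAt (x₀ : M) (y v w : EuclideanSpace ℝ (Fin n)) :
    metricForm x₀ y v w =
      metricAt ((extChartAt (𝓡 n) x₀).symm y) (frame x₀ y v) (frame x₀ y w) := by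
  rw [metricForm_apply, metricAt_frame]

theorem metricAt_self_chart_symm [IsManifold (𝓡 n) ∞ M] (X : ∀ p : M, TangentSpace (𝓡 n) p)
    (hy : y ∈ (extChartAt (𝓡 n) x₀).target) :
    metricAt ((extChartAt (𝓡 n) x₀).symm y) (X ((extChartAt (𝓡 n) x₀).symm y))
      (X ((extChartAt (𝓡 n) x₀).symm y)) =
      metricForm x₀ y (localField X x₀ y) (localField X x₀ y) := by
  rw [metricForm_eq_metricAt, frame_localField X hy]

variable [IsManifold (𝓡 n) ∞ M]
    [IsContMDiffRiemannianBundle (𝓡 n) ∞ (EuclideanSpace ℝ (Fin n))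
      (fun p : M ↦ TangentSpace (𝓡 n) p)]

theorem differentiableAt_metricMatrix (hy : y ∈ (extChartAt (𝓡 n) x₀).target) (i j : Fin n) :
    DifferentiableAt ℝ (fun z ↦ metricMatrix x₀ z i j) y :=
  ((contDiffOn_metricMatrix x₀ i j).contDiffAt
    ((isOpen_extChartAt_target x₀).mem_nhds hy)).differentiableAt (by simp)

theorem differentiableAt_sum_smul {E F : Type*} [NormedAddCommGroup E] [NormedSpace ℝ E]
    [NormedAddCommGroup F] [NormedSpace ℝ F] {ι : Type*} [Fintype ι] (c : ι → ι → E → ℝ)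
    (b : ι → ι → F) {y : E} (hc : ∀ i j, DifferentiableAt ℝ (c i j) y) :
    DifferentiableAt ℝ (fun z ↦ ∑ i, ∑ j, c i j z • b i j) y :=
  DifferentiableAt.fun_sum fun i _ ↦ DifferentiableAt.fun_sum fun j _ ↦
    DifferentiableAt.smul_const (hc i j) _

set_option synthInstance.maxHeartbeats 200000 in
theorem differentiableAt_metricForm (hy : y ∈ (extChartAt (𝓡 n) x₀).target) :
    DifferentiableAt ℝ (metricForm x₀) y := by
  exact differentiableAt_sum_smul _ coordForm (differentiableAt_metricMatrix hy)

set_option synthInstance.maxHeartbeats 200000 in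
theorem fderiv_metricForm (hy : y ∈ (extChartAt (𝓡 n) x₀).target)
    (u v w : EuclideanSpace ℝ (Fin n)) : fderiv ℝ (metricForm x₀) y u v w =
      ∑ i, ∑ j, fderiv ℝ (fun z ↦ metricMatrix x₀ z i j) y u * v i * w j := by
  have h1 := ((differentiableAt_metricForm hy).hasFDerivAt.clm_apply
    (hasFDerivAt_const v y)).clm_apply (hasFDerivAt_const w y)
  have h2 : HasFDerivAt (fun z ↦ ∑ i, ∑ j, metricMatrix x₀ z i j * v i * w j)
      (∑ i, ∑ j, w j • v i • fderiv ℝ (fun z ↦ metricMatrix x₀ z i j) y) y :=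
    HasFDerivAt.fun_sum fun i _ ↦ HasFDerivAt.fun_sum fun j _ ↦
      ((differentiableAt_metricMatrix hy i j).hasFDerivAt.mul_const _).mul_const _
  simp only [metricForm_apply] at h1
  have := congrArg (fun L : EuclideanSpace ℝ (Fin n) →L[ℝ] ℝ ↦ L u) (h1.unique h2)
  simp at this
  rw [this]
  refine Finset.sum_congr rfl fun i _ ↦ Finset.sum_congr rfl fun j _ ↦ by ring

theorem continuousAt_metricForm {x₀ : M} {y : EuclideanSpace ℝ (Fin n)}
    (hy : y ∈ (extChartAt (𝓡 n) x₀).target) (v w : EuclideanSpace ℝ (Fin n)) :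
    ContinuousAt (fun z ↦ metricForm x₀ z v w) y := by
  simp only [metricForm_apply]
  exact tendsto_finsetSum _ fun i _ ↦ tendsto_finsetSum _ fun j _ ↦
    (((differentiableAt_metricMatrix hy i j).continuousAt.mul_const _).mul_const _)

/-- The coordinate expression of `£_X g` is the Lie derivative of bilinear forms on `ℝⁿ`. -/
theorem lieMetricMatrix_eq_lieForm {X : ∀ p : M, TangentSpace (𝓡 n) p}
    (hy : y ∈ (extChartAt (𝓡 n) x₀).target) (hX : DifferentiableAt ℝ (localField X x₀) y)
    (i j : Fin n) : lieMetricMatrix X x₀ y i j =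
      lieForm (metricForm x₀) (localField X x₀) y (unitVec i) (unitVec j) := by
  have h1 : ∀ (k : Fin n) v, fderiv ℝ (localField X x₀) y v k =
      fderiv ℝ (fieldComponent X x₀ k) y v := fun k v ↦ by
    have := ((EuclideanSpace.proj k : EuclideanSpace ℝ (Fin n) →L[ℝ] ℝ).hasFDerivAt.comp y
      hX.hasFDerivAt).fderiv
    exact (congrArg (fun L : EuclideanSpace ℝ (Fin n) →L[ℝ] ℝ ↦ L v) this).symm
  have h2 : ∀ a b, fderiv ℝ (fun z ↦ metricMatrix x₀ z a b) y (localField X x₀ y) =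
      ∑ k, fieldComponent X x₀ k y * metricDeriv x₀ k a b y := fun a b ↦ by
    conv_lhs => rw [← sum_unitVec (localField X x₀ y)]
    simp only [map_sum, map_smul, smul_eq_mul]
    rfl
  simp only [lieForm, fderiv_metricForm hy, metricForm_apply, h1]
  simp only [lieMetricMatrix, Matrix.of_apply, Finset.sum_add_distrib]
  congr 1
  · congr 1
    · simp [h2, unitVec]
    · simp [unitVec, partialDeriv]
  · simp [unitVec, partialDeriv]

end Transition

/-! ### The divergence of a vector field -/

noncomputable section Divergence

open Set Filter Matrix

variable {n : ℕ} {M : Type*} [TopologicalSpace M] [ChartedSpace (EuclideanSpace ℝ (Fin n)) M]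
  [Bundle.RiemannianBundle (fun p : M ↦ TangentSpace (𝓡 n) p)]

/-- The divergence of a vector field in the chart at `x₀`, as half the trace of the Lie derivative
of the metric. -/
def chartDiv (X : ∀ p : M, TangentSpace (𝓡 n) p) (x₀ : M) (y : EuclideanSpace ℝ (Fin n)) : ℝ :=
  (1 / 2) * ∑ i, ∑ j, (metricMatrix x₀ y)⁻¹ i j * lieMetricMatrix X x₀ y i j

/-- The divergence of a vector field on a Riemannian manifold, computed at each point in the
preferred chart. -/
def divergence (X : ∀ p : M, TangentSpace (𝓡 n) p) (p : M) : ℝ :=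
  chartDiv X p (extChartAt (𝓡 n) p p)

theorem chartDiv_eq_trace (X : ∀ p : M, TangentSpace (𝓡 n) p) (x₀ : M)
    (y : EuclideanSpace ℝ (Fin n)) :
    chartDiv X x₀ y = (1 / 2) * ((metricMatrix x₀ y)⁻¹ * lieMetricMatrix X x₀ y).trace := by
  have hs : ((metricMatrix x₀ y)⁻¹)ᵀ = (metricMatrix x₀ y)⁻¹ := by
    rw [transpose_nonsing_inv]
    congr 1
    ext i j
    exact metricMatrix_symm x₀ y j i
  rw [chartDiv, ← hs, Matrix.trace, Finset.sum_comm]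
  simp [Matrix.mul_apply, hs]

variable [IsManifold (𝓡 n) ∞ M]
    [IsContMDiffRiemannianBundle (𝓡 n) ∞ (EuclideanSpace ℝ (Fin n))
      (fun p : M ↦ TangentSpace (𝓡 n) p)] {x₁ x₀ : M} {y : EuclideanSpace ℝ (Fin n)}

/-- The divergence is the same in any two charts: both `g` and `£_X g` transform by congruence with
the Jacobi matrix. -/
theorem chartDiv_transition {X : ∀ p : M, TangentSpace (𝓡 n) p} (hy : y ∈ overlap x₁ x₀)
    (h1 : DifferentiableAt ℝ (localField X x₁) y)
    (h0 : DifferentiableAt ℝ (localField X x₀) (transition x₁ x₀ y)) :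
    chartDiv X x₁ y = chartDiv X x₀ (transition x₁ x₀ y) := by
  have hL : lieMetricMatrix X x₁ y = (jacobiMatrix x₁ x₀ y).transpose *
      lieMetricMatrix X x₀ (transition x₁ x₀ y) * jacobiMatrix x₁ x₀ y := by
    refine eq_congruence fun i j ↦ ?_
    have hev := (isOpen_overlap x₁ x₀).eventually_mem hy
    rw [lieMetricMatrix_eq_lieForm hy.1 h1, lieForm_pullback
      ((contDiffAt_transition hy).of_le ENat.LEInfty.out)
      (differentiableAt_metricForm (transition_mem_target hy))
      (differentiableAt_metricForm hy.1) h0 h1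
      (hev.mono fun z hz v w ↦ by
        rw [metricForm_eq_metricAt, metricForm_eq_metricAt, chart_symm_transition hz,
          frame_transition hz, frame_transition hz])
      (hev.mono fun z hz ↦ localField_transition X hz)]
    have : ∀ i, fderiv ℝ (transition x₁ x₀) y (unitVec i) =
        ∑ a, jacobiMatrix x₁ x₀ y a i • unitVec a := fun i ↦
      (sum_unitVec (fderiv ℝ (transition x₁ x₀) y (unitVec i))).symm
    rw [this i, this j]
    simp only [lieMetricMatrix_eq_lieForm (transition_mem_target hy) h0]
    simp only [lieForm, map_sum, map_smul, _root_.sum_apply,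
      _root_.smul_apply, smul_eq_mul, add_mul, Finset.sum_add_distrib, Finset.mul_sum]
    congr 1
    · congr 1
      all_goals
        rw [Finset.sum_comm]
        refine Finset.sum_congr rfl fun a _ ↦ Finset.sum_congr rfl fun b _ ↦ by ring
    · rw [Finset.sum_comm]
      refine Finset.sum_congr rfl fun a _ ↦ Finset.sum_congr rfl fun b _ ↦ by ring
  rw [chartDiv_eq_trace, chartDiv_eq_trace, hL, metricMatrix_transition hy,
    trace_congruence _ _ _ (det_jacobiMatrix_ne_zero hy).isUnit]

end Divergence

/-! ### The Riemannian volume in charts -/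

noncomputable section Volume

open Set Filter MeasureTheory

variable {n : ℕ} {M : Type*} [TopologicalSpace M] [ChartedSpace (EuclideanSpace ℝ (Fin n)) M]

theorem measurableSet_inter_preimage {α β : Type*} [TopologicalSpace α] [MeasurableSpace α]
    [BorelSpace α] [TopologicalSpace β] [MeasurableSpace β] [BorelSpace β] {f : α → β} {s : Set α}
    {t : Set β} (hf : ContinuousOn f s) (hs : MeasurableSet s) (ht : MeasurableSet t) :
    MeasurableSet (s ∩ f ⁻¹' t) := by
  have h := hs.subtype_image (hf.domRestrict.measurable ht)
  convert h using 1
  ext x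
  simp [and_comm]

variable [MeasurableSpace M] [BorelSpace M]

theorem aemeasurable_chart_symm (x₀ : M) :
    AEMeasurable (extChartAt (𝓡 n) x₀).symm
      (volume.restrict (extChartAt (𝓡 n) x₀).target) :=
  (continuousOn_extChartAt_symm x₀).aemeasurable (isOpen_extChartAt_target x₀).measurableSet

variable [Bundle.RiemannianBundle (fun p : M ↦ TangentSpace (𝓡 n) p)]

theorem chartVolume_apply (x₀ : M) {A : Set M} (hA : MeasurableSet A) :
    chartVolume n x₀ A = ∫⁻ y in (extChartAt (𝓡 n) x₀).target ∩ (extChartAt (𝓡 n) x₀).symm ⁻¹' A,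
      ENNReal.ofReal √(metricMatrix x₀ y).det := by
  rw [chartVolume, Measure.map_apply_of_aemeasurable
    ((aemeasurable_chart_symm x₀).mono_ac (withDensity_absolutelyContinuous _ _)) hA,
    withDensity_apply', Measure.restrict_restrict' (isOpen_extChartAt_target x₀).measurableSet,
    inter_comm]

theorem chartVolume_compl_source (x₀ : M) :
    chartVolume n x₀ (extChartAt (𝓡 n) x₀).sourceᶜ = 0 := by
  rw [chartVolume_apply x₀ (isOpen_extChartAt_source x₀).measurableSet.compl]
  convert lintegral_zero_measure _
  rw [Measure.restrict_eq_zero]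
  convert measure_empty (μ := volume)
  exact eq_empty_of_forall_notMem fun y hy ↦ hy.2 ((extChartAt (𝓡 n) x₀).map_target hy.1)

variable [IsManifold (𝓡 n) ∞ M]

/-- On the common domain of two charts the two chart volumes agree: this is the change of variables
formula. -/
theorem chartVolume_inter_source (x₁ x₀ : M) {A : Set M} (hA : MeasurableSet A) :
    chartVolume n x₁ (A ∩ (extChartAt (𝓡 n) x₀).source) =
      chartVolume n x₀ (A ∩ (extChartAt (𝓡 n) x₁).source) := by
  have hm : ∀ x₁ x₀ : M, MeasurableSet
      (overlap (n := n) x₁ x₀ ∩ (extChartAt (𝓡 n) x₁).symm ⁻¹' A) := fun x₁ x₀ ↦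
    measurableSet_inter_preimage ((continuousOn_extChartAt_symm x₁).mono inter_subset_left)
      (isOpen_overlap x₁ x₀).measurableSet hA
  have hset : ∀ x₁ x₀ : M, (extChartAt (𝓡 n) x₁).target ∩
      (extChartAt (𝓡 n) x₁).symm ⁻¹' (A ∩ (extChartAt (𝓡 n) x₀).source) =
        overlap x₁ x₀ ∩ (extChartAt (𝓡 n) x₁).symm ⁻¹' A := fun x₁ x₀ ↦ by
    ext y; simp only [overlap, mem_inter_iff, mem_preimage]; tauto
  have himage : overlap x₀ x₁ ∩ (extChartAt (𝓡 n) x₀).symm ⁻¹' A =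
      transition x₁ x₀ '' (overlap x₁ x₀ ∩ (extChartAt (𝓡 n) x₁).symm ⁻¹' A) := by
    apply Subset.antisymm
    · rintro y ⟨hy, hyA⟩
      refine ⟨_, ⟨transition_mem_overlap hy, ?_⟩, transition_transition hy⟩
      rwa [mem_preimage, chart_symm_transition hy]
    · rintro _ ⟨y, ⟨hy, hyA⟩, rfl⟩
      refine ⟨transition_mem_overlap hy, ?_⟩
      rwa [mem_preimage, chart_symm_transition hy]
  rw [chartVolume_apply x₁ (hA.inter (isOpen_extChartAt_source x₀).measurableSet),
    chartVolume_apply x₀ (hA.inter (isOpen_extChartAt_source x₁).measurableSet), hset, hset,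
    himage, lintegral_image_eq_lintegral_abs_det_fderiv_mul volume (hm x₁ x₀)
      (fun y hy ↦ ((contDiffAt_transition hy.1).differentiableAt
        (by simp)).hasFDerivAt.hasFDerivWithinAt)
      ((injOn_transition x₁ x₀).mono inter_subset_left)]
  refine setLIntegral_congr_fun (hm x₁ x₀) fun y hy ↦ ?_
  rw [sqrt_det_transition hy.1, ENNReal.ofReal_mul (abs_nonneg _)]

/-- The Riemannian volume restricts to the chart volume on the domain of each chart. -/
theorem riemannianVolume_restrict_source (x₀ : M) :
    (riemannianVolume n M).restrict (extChartAt (𝓡 n) x₀).source = chartVolume n x₀ := by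
  have hs : MeasurableSet (extChartAt (𝓡 n) x₀).source :=
    (isOpen_extChartAt_source x₀).measurableSet
  have hle : ∀ x₁ : M, chartVolume n x₁ ≤ riemannianVolume n M := fun x₁ ↦
    le_iSup (fun x : M ↦ chartVolume n x) x₁
  apply le_antisymm
  · have hub : riemannianVolume n M ≤
        (riemannianVolume n M).restrict (extChartAt (𝓡 n) x₀).sourceᶜ + chartVolume n x₀ := by
      refine iSup_le fun x₁ ↦ ?_
      rw [← Measure.restrict_compl_add_restrict (μ := chartVolume n x₁) hs]
      refine add_le_add (Measure.restrict_mono subset_rfl (hle x₁)) ?_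
      refine Measure.le_iff.2 fun A hA ↦ ?_
      rw [Measure.restrict_apply hA, chartVolume_inter_source x₁ x₀ hA]
      exact measure_mono inter_subset_left
    calc _ ≤ ((riemannianVolume n M).restrict (extChartAt (𝓡 n) x₀).sourceᶜ
          + chartVolume n x₀).restrict (extChartAt (𝓡 n) x₀).source :=
        Measure.restrict_mono subset_rfl hub
      _ = (chartVolume n x₀).restrict (extChartAt (𝓡 n) x₀).source := by
        rw [Measure.restrict_add, Measure.restrict_restrict hs, inter_compl_self,
          Measure.restrict_empty, zero_add]
      _ ≤ _ := Measure.restrict_le_self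
  · rw [← Measure.restrict_eq_self_of_ae_mem (μ := chartVolume n x₀)
      (s := (extChartAt (𝓡 n) x₀).source)
      (mem_ae_iff.2 (chartVolume_compl_source x₀))]
    exact Measure.restrict_mono subset_rfl (hle x₀)

variable [IsContMDiffRiemannianBundle (𝓡 n) ∞ (EuclideanSpace ℝ (Fin n))
    (fun p : M ↦ TangentSpace (𝓡 n) p)]

/-- A function supported in the domain of a chart is integrated in that chart. -/
theorem integral_eq_integral_chart (x₀ : M) {f : M → ℝ}
    (hf : AEStronglyMeasurable f (riemannianVolume n M))
    (h0 : ∀ p ∉ (extChartAt (𝓡 n) x₀).source, f p = 0) :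
    ∫ p, f p ∂(riemannianVolume n M) = ∫ y in (extChartAt (𝓡 n) x₀).target,
      √(metricMatrix x₀ y).det * f ((extChartAt (𝓡 n) x₀).symm y) := by
  rw [← setIntegral_eq_integral_of_forall_compl_eq_zero h0, riemannianVolume_restrict_source]
  have hf' : AEStronglyMeasurable f (chartVolume n x₀) := by
    rw [← riemannianVolume_restrict_source]; exact hf.restrict
  rw [chartVolume] at hf' ⊢
  rw [integral_map ((aemeasurable_chart_symm x₀).mono_ac (withDensity_absolutelyContinuous _ _))
    hf', integral_withDensity_eq_integral_toReal_smul₀ (aemeasurable_density x₀)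
      (ae_of_all _ fun _ ↦ ENNReal.ofReal_lt_top)]
  simp [ENNReal.toReal_ofReal (Real.sqrt_nonneg _)]

/-- Nonempty open sets have positive volume, so continuous functions that agree almost everywhere
agree. -/
instance isOpenPosMeasure_riemannianVolume :
    (riemannianVolume n M).IsOpenPosMeasure := by
  refine ⟨fun U hU ⟨p, hp⟩ h0 ↦ ?_⟩
  have h1 : chartVolume n p U = 0 :=
    le_antisymm (h0 ▸ le_iSup (fun x : M ↦ chartVolume n x) p U) bot_le
  set T := (extChartAt (𝓡 n) p).target ∩ (extChartAt (𝓡 n) p).symm ⁻¹' U with hT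
  have hTo : IsOpen T :=
    (continuousOn_extChartAt_symm p).isOpen_inter_preimage (isOpen_extChartAt_target p) hU
  have hTn : T.Nonempty := ⟨extChartAt (𝓡 n) p p, mem_extChartAt_target p, by simpa using hp⟩
  rw [chartVolume_apply p hU.measurableSet, lintegral_eq_zero_iff'
    ((aemeasurable_density p).mono_measure (Measure.restrict_mono inter_subset_left le_rfl)),
    EventuallyEq, ae_restrict_iff' hTo.measurableSet] at h1
  refine hTo.measure_ne_zero volume hTn (measure_mono_null (fun y hy ↦ ?_) (mem_ae_iff.1 h1))
  simp only [mem_compl_iff, mem_ofPred_eq, not_forall]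
  refine ⟨hy, ?_⟩
  simp only [Pi.zero_apply, ENNReal.ofReal_eq_zero, not_le]
  exact Real.sqrt_pos.2 (det_metricMatrix_pos hy.1)

end Volume

/-! ### The distance and Lipschitz functions in charts -/

noncomputable section ChartDistance

open Set Filter MeasureTheory
open scoped NNReal

variable {n : ℕ} {M : Type*} [MetricSpace M] [ChartedSpace (EuclideanSpace ℝ (Fin n)) M]
  [Bundle.RiemannianBundle (fun p : M ↦ TangentSpace (𝓡 n) p)]

/-- A bound on the Riemannian metric in terms of the norm by which lengths of paths are defined. -/
theorem enorm_tangent_le (p : M) (v : TangentSpace (𝓡 n) p) {B : ℝ} (hB : 0 ≤ B)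
    (h : metricAt p v v ≤ B ^ 2) :
    ‖v‖ₑ ≤ ENNReal.ofReal B := by
  have h1 : ‖v‖ ≤ B := by
    refine le_of_sq_le_sq ?_ hB
    rw [← real_inner_self_eq_norm_sq]
    exact h
  rw [← ofReal_norm]
  exact ENNReal.ofReal_le_ofReal h1

variable [IsManifold (𝓡 n) ∞ M] [IsRiemannianManifold (𝓡 n) M]

/-- The image under the inverse chart of a segment is a path, whose length bounds the distance of
its end points. -/
theorem dist_chart_symm_le {x₀ : M} {y z : EuclideanSpace ℝ (Fin n)} {B : ℝ} (hB : 0 ≤ B)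
    (hT : segment ℝ y z ⊆ (extChartAt (𝓡 n) x₀).target)
    (h : ∀ w ∈ segment ℝ y z, metricForm x₀ w (z - y) (z - y) ≤ B ^ 2) :
    dist ((extChartAt (𝓡 n) x₀).symm y) ((extChartAt (𝓡 n) x₀).symm z) ≤ B := by
  let η : ℝ →ᴬ[ℝ] EuclideanSpace ℝ (Fin n) := ContinuousAffineMap.lineMap y z
  have hη : ∀ t ∈ Icc (0 : ℝ) 1, η t ∈ segment ℝ y z := fun t ht ↦ by
    rw [segment_eq_image_lineMap]; exact ⟨t, ht, rfl⟩
  have hηs : ContMDiffOn 𝓘(ℝ, ℝ) 𝓘(ℝ, EuclideanSpace ℝ (Fin n)) 1 η (Icc 0 1) :=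
    η.contDiff.contMDiff.contMDiffOn
  have hγ : ContMDiffOn 𝓘(ℝ, ℝ) (𝓡 n) 1 ((extChartAt (𝓡 n) x₀).symm ∘ η) (Icc 0 1) :=
    (contMDiffOn_extChartAt_symm x₀).comp hηs fun t ht ↦ hT (hη t ht)
  have hle := edist_le_pathELength zero_le_one hγ
  have h0 : η 0 = y := AffineMap.lineMap_apply_zero y z
  have h1 : η 1 = z := AffineMap.lineMap_apply_one y z
  have hd : ∀ t, HasFDerivAt η (ContinuousLinearMap.toSpanSingleton ℝ (z - y)) t := fun t ↦ by
    have := (AffineMap.hasDerivAt_lineMap (a := y) (b := z) (x := t)).hasFDerivAt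
    exact this
  have hlen : Manifold.pathELength (𝓡 n) ((extChartAt (𝓡 n) x₀).symm ∘ η) 0 1 ≤
      ∫⁻ t in Ioo (0 : ℝ) 1, ENNReal.ofReal B := by
    rw [Manifold.pathELength_eq_lintegral_mfderiv_Ioo]
    refine setLIntegral_mono' measurableSet_Ioo fun t ht ↦ ?_
    have ht' := hη t (Ioo_subset_Icc_self ht)
    have hc := ((mdifferentiableAt_chart_symm (hT ht')).hasMFDerivAt.comp t
      (hd t).hasMFDerivAt).mfderiv
    have hv : (mfderiv 𝓘(ℝ, ℝ) (𝓡 n) ((extChartAt (𝓡 n) x₀).symm ∘ η) t 1 :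
        EuclideanSpace ℝ (Fin n)) = frame x₀ (η t) (z - y) := by
      have h2 := congrArg (fun L : ℝ →L[ℝ] EuclideanSpace ℝ (Fin n) ↦ L 1) hc
      refine h2.trans ?_
      have h3 : ContinuousLinearMap.toSpanSingleton ℝ (z - y) (1 : ℝ) = z - y := by simp
      exact congrArg (frame x₀ (η t)) h3
    have h4 := h _ ht'
    rw [metricForm_eq_metricAt, ← hv] at h4
    exact enorm_tangent_le _ _ hB h4
  have h5 := hle.trans hlen
  simp only [Function.comp_apply, h0, h1, lintegral_const, MeasurableSet.univ,
    Measure.restrict_apply, univ_inter, Real.volume_Ioo, sub_zero, ENNReal.ofReal_one,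
    mul_one, edist_dist] at h5
  exact (ENNReal.ofReal_le_ofReal_iff hB).1 h5

variable [IsContMDiffRiemannianBundle (𝓡 n) ∞ (EuclideanSpace ℝ (Fin n))
    (fun p : M ↦ TangentSpace (𝓡 n) p)]

/-- Every point has a chart ball on which the inverse chart is Lipschitz. -/
theorem exists_ball_lipschitzOn_chart_symm (x₀ : M) : ∃ r > 0, ∃ C : ℝ≥0,
    Metric.ball (extChartAt (𝓡 n) x₀ x₀) r ⊆ (extChartAt (𝓡 n) x₀).target ∧
    LipschitzOnWith C (extChartAt (𝓡 n) x₀).symm (Metric.ball (extChartAt (𝓡 n) x₀ x₀) r) := by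
  have hx := mem_extChartAt_target (I := 𝓡 n) x₀
  set S : EuclideanSpace ℝ (Fin n) → ℝ := fun w ↦ ∑ i, ∑ j, |metricMatrix x₀ w i j| with hS
  have hSc : ContinuousAt S (extChartAt (𝓡 n) x₀ x₀) :=
    tendsto_finsetSum _ fun i _ ↦ tendsto_finsetSum _ fun j _ ↦
      (differentiableAt_metricMatrix hx i j).continuousAt.abs
  have hev := (hSc.eventually (gt_mem_nhds (lt_add_one _))).and
    ((isOpen_extChartAt_target x₀).mem_nhds hx)
  obtain ⟨r, hr, hball⟩ := Metric.eventually_nhds_iff_ball.1 hev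
  have hC : 0 ≤ S (extChartAt (𝓡 n) x₀ x₀) + 1 :=
    add_nonneg (Finset.sum_nonneg fun i _ ↦ Finset.sum_nonneg fun j _ ↦ abs_nonneg _) zero_le_one
  refine ⟨r, hr, (√(S (extChartAt (𝓡 n) x₀ x₀) + 1)).toNNReal,
    fun w hw ↦ (hball w hw).2, LipschitzOnWith.of_dist_le_mul fun y hy z hz ↦ ?_⟩
  have hseg := (convex_ball (extChartAt (𝓡 n) x₀ x₀) r).segment_subset hy hz
  refine dist_chart_symm_le (by positivity)
    (fun w hw ↦ (hball w (hseg hw)).2) fun w hw ↦ ?_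
  rw [Real.coe_toNNReal _ (Real.sqrt_nonneg _), mul_pow, Real.sq_sqrt hC, dist_comm, dist_eq_norm,
    metricForm_apply]
  have hcoord : ∀ (v : EuclideanSpace ℝ (Fin n)) i, |v i| ≤ ‖v‖ := fun v i ↦
    PiLp.norm_apply_le v i
  calc _ ≤ ∑ i, ∑ j, |metricMatrix x₀ w i j| * (‖z - y‖ ^ 2) := by
        refine Finset.sum_le_sum fun i _ ↦ Finset.sum_le_sum fun j _ ↦ ?_
        refine (le_abs_self _).trans ?_
        rw [abs_mul, abs_mul, mul_assoc, sq]
        gcongr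
        · exact hcoord _ i
        · exact hcoord _ j
    _ = S w * ‖z - y‖ ^ 2 := by simp only [hS, Finset.sum_mul]
    _ ≤ _ := by gcongr; exact (hball w (hseg hw)).1.le

/-- The differential of a `K`-Lipschitz function has norm at most `K` for the Riemannian metric. -/
theorem abs_fderiv_comp_chart_symm_le {K : ℝ≥0} {f : M → ℝ} (hf : LipschitzWith K f) {x₀ : M}
    {y : EuclideanSpace ℝ (Fin n)} (hy : y ∈ (extChartAt (𝓡 n) x₀).target)
    (hd : DifferentiableAt ℝ (f ∘ (extChartAt (𝓡 n) x₀).symm) y) (v : EuclideanSpace ℝ (Fin n)) :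
    |fderiv ℝ (f ∘ (extChartAt (𝓡 n) x₀).symm) y v| ≤ K * √(metricForm x₀ y v v) := by
  -- near `y` the form `metricForm` is at most `B ^ 2` on `v` for every larger `B`, which bounds the
  -- difference quotients of `f` in the direction `v`
  have key : ∀ B : ℝ, √(metricForm x₀ y v v) < B →
      |fderiv ℝ (f ∘ (extChartAt (𝓡 n) x₀).symm) y v| ≤ K * B := by
    intro B hB
    have hB0 : 0 < B := (Real.sqrt_nonneg _).trans_lt hB
    have hev := ((continuousAt_metricForm hy v v).eventually
      (gt_mem_nhds ((Real.sqrt_lt' hB0).1 hB))).and ((isOpen_extChartAt_target x₀).mem_nhds hy)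
    obtain ⟨r, hr, hball⟩ := Metric.eventually_nhds_iff_ball.1 hev
    have hlim := (hd.hasFDerivAt.hasLineDerivAt v).tendsto_slope_zero_right
    refine le_of_tendsto hlim.abs ?_
    have hc : Tendsto (fun t : ℝ ↦ y + t • v) (𝓝[>] 0) (𝓝 y) := by
      have : Continuous fun t : ℝ ↦ y + t • v := by fun_prop
      have := this.tendsto 0
      simp only [zero_smul, add_zero] at this
      exact this.mono_left nhdsWithin_le_nhds
    filter_upwards [hc.eventually (Metric.ball_mem_nhds y hr), self_mem_nhdsWithin] with t ht ht0
    rw [mem_Ioi] at ht0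
    have hseg := (convex_ball y r).segment_subset (Metric.mem_ball_self hr) ht
    have hdist := dist_chart_symm_le (x₀ := x₀) (y := y) (z := y + t • v) (B := t * B)
      (by positivity) (fun w hw ↦ (hball w (hseg hw)).2) fun w hw ↦ by
        simp only [add_sub_cancel_left, map_smul, _root_.smul_apply, smul_eq_mul]
        have := (hball w (hseg hw)).1.le
        nlinarith [mul_le_mul_of_nonneg_left this (sq_nonneg t)]
    have h1 := hf.dist_le_mul ((extChartAt (𝓡 n) x₀).symm (y + t • v))
      ((extChartAt (𝓡 n) x₀).symm y)
    rw [dist_comm] at hdist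
    rw [smul_eq_mul, abs_mul, abs_inv, abs_of_pos ht0, inv_mul_le_iff₀ ht0]
    rw [Real.dist_eq] at h1
    refine h1.trans ?_
    calc (K : ℝ) * _ ≤ K * (t * B) := by gcongr
      _ = _ := by ring
  have hcont : Tendsto (fun B : ℝ ↦ K * B) (𝓝[>] √(metricForm x₀ y v v))
      (𝓝 (K * √(metricForm x₀ y v v))) :=
    ((continuous_const.mul continuous_id).tendsto _).mono_left nhdsWithin_le_nhds
  exact ge_of_tendsto hcont (by filter_upwards [self_mem_nhdsWithin] with B hB using key B hB)

end ChartDistance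

/-! ### The divergence in charts -/

noncomputable section ChartDivergence

open Set Filter MeasureTheory
open scoped NNReal

variable {n : ℕ} {M : Type*} [TopologicalSpace M] [ChartedSpace (EuclideanSpace ℝ (Fin n)) M]
  [Bundle.RiemannianBundle (fun p : M ↦ TangentSpace (𝓡 n) p)] [IsManifold (𝓡 n) ∞ M]
  [IsContMDiffRiemannianBundle (𝓡 n) ∞ (EuclideanSpace ℝ (Fin n))
    (fun p : M ↦ TangentSpace (𝓡 n) p)]
  {X : ∀ p : M, TangentSpace (𝓡 n) p} {x₀ : M}

/-- The divergence may be computed in any chart. -/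
theorem divergence_eq_chartDiv
    (hX : ContMDiff (𝓡 n) (𝓡 n).tangent ∞ (fun p ↦ (⟨p, X p⟩ : TangentBundle (𝓡 n) M)))
    {p : M} (hp : p ∈ (extChartAt (𝓡 n) x₀).source) :
    divergence X p = chartDiv X x₀ (extChartAt (𝓡 n) x₀ p) := by
  have hy : extChartAt (𝓡 n) p p ∈ overlap (n := n) p x₀ :=
    ⟨mem_extChartAt_target p, by simpa using hp⟩
  have h := chartDiv_transition hy (differentiableAt_localField hX hy.1)
    (differentiableAt_localField hX (transition_mem_target hy))
  rw [divergence, h, transition, extChartAt_to_inv]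

theorem divergence_chart_symm
    (hX : ContMDiff (𝓡 n) (𝓡 n).tangent ∞ (fun p ↦ (⟨p, X p⟩ : TangentBundle (𝓡 n) M)))
    {y : EuclideanSpace ℝ (Fin n)} (hy : y ∈ (extChartAt (𝓡 n) x₀).target) :
    divergence X ((extChartAt (𝓡 n) x₀).symm y) = chartDiv X x₀ y := by
  rw [divergence_eq_chartDiv hX ((extChartAt (𝓡 n) x₀).map_target hy),
    (extChartAt (𝓡 n) x₀).right_inv hy]

variable (X x₀) in
/-- The `k`-th component of the vector density `√(det g) X` in the chart at `x₀`. -/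
def densityComponent (k : Fin n) (y : EuclideanSpace ℝ (Fin n)) : ℝ :=
  √(metricMatrix x₀ y).det * localField X x₀ y k

theorem contDiffOn_densityComponent
    (hX : ContMDiff (𝓡 n) (𝓡 n).tangent ∞ (fun p ↦ (⟨p, X p⟩ : TangentBundle (𝓡 n) M)))
    (k : Fin n) : ContDiffOn ℝ ∞ (densityComponent X x₀ k) (extChartAt (𝓡 n) x₀).target :=
  (contDiffOn_sqrt_det x₀).mul
    ((EuclideanSpace.proj k : EuclideanSpace ℝ (Fin n) →L[ℝ] ℝ).contDiff.comp_contDiffOn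
      (contDiffOn_localField hX x₀))

/-- Voss's formula on the manifold: `√(det g) div X` is the Euclidean divergence of `√(det g) X`. -/
theorem sqrt_det_mul_chartDiv
    (hX : ContMDiff (𝓡 n) (𝓡 n).tangent ∞ (fun p ↦ (⟨p, X p⟩ : TangentBundle (𝓡 n) M)))
    {y : EuclideanSpace ℝ (Fin n)} (hy : y ∈ (extChartAt (𝓡 n) x₀).target) :
    √(metricMatrix x₀ y).det * chartDiv X x₀ y =
      ∑ k, partialDeriv k (densityComponent X x₀ k) y :=
  sqrt_det_mul_half_trace_lie (V := fieldComponent X x₀)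
    (differentiableAt_metricMatrix hy)
    (fun k ↦ ((EuclideanSpace.proj k : EuclideanSpace ℝ (Fin n) →L[ℝ] ℝ).differentiableAt.comp y
      (differentiableAt_localField hX hy))) (metricMatrix_symm x₀) (det_metricMatrix_pos hy)

/-- Near `p` the divergence is computed in the chart at `p`, where it is continuous by Voss's
formula. -/
theorem continuous_divergence
    (hX : ContMDiff (𝓡 n) (𝓡 n).tangent ∞ (fun p ↦ (⟨p, X p⟩ : TangentBundle (𝓡 n) M))) :
    Continuous (divergence X) := by
  refine continuous_iff_continuousAt.2 fun p ↦ ?_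
  have hT := (isOpen_extChartAt_target (I := 𝓡 n) p).mem_nhds (mem_extChartAt_target p)
  have h1 : ContinuousAt (chartDiv X p) (extChartAt (𝓡 n) p p) := by
    have hc : ContinuousAt (fun y ↦ (√(metricMatrix p y).det)⁻¹ *
        ∑ k, partialDeriv k (densityComponent X p k) y) (extChartAt (𝓡 n) p p) := by
      refine ContinuousAt.mul (ContinuousAt.inv₀ ((contDiffOn_sqrt_det p).continuousOn.continuousAt
        hT) (Real.sqrt_pos.2 (det_metricMatrix_pos (mem_extChartAt_target p))).ne') ?_
      refine tendsto_finsetSum _ fun k _ ↦ ?_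
      have := ((contDiffOn_densityComponent (x₀ := p) hX k).contDiffAt hT).fderiv_right
        (m := 0) (by simp)
      exact this.continuousAt.clm_apply continuousAt_const
    refine hc.congr ?_
    filter_upwards [hT] with y hy
    rw [← sqrt_det_mul_chartDiv hX hy, inv_mul_cancel_left₀
      (Real.sqrt_pos.2 (det_metricMatrix_pos hy)).ne']
  have h2 := ContinuousAt.comp h1 (continuousAt_extChartAt (I := 𝓡 n) p)
  refine h2.congr ?_
  filter_upwards [extChartAt_source_mem_nhds (I := 𝓡 n) p] with q hq
  exact (divergence_eq_chartDiv hX hq).symm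

theorem continuous_metricAt_self
    (hX : ContMDiff (𝓡 n) (𝓡 n).tangent ∞ (fun p ↦ (⟨p, X p⟩ : TangentBundle (𝓡 n) M))) :
    Continuous fun p ↦ metricAt p (X p) (X p) :=
  (ContMDiff.inner_bundle (IB := 𝓡 n) (F := EuclideanSpace ℝ (Fin n))
    (E := fun p : M ↦ TangentSpace (𝓡 n) p) hX hX).continuous

end ChartDivergence

/-! ### Integration by parts on Euclidean space -/

section Euclidean

open Set Filter MeasureTheory
open scoped NNReal

variable {n : ℕ}

/-- Integration by parts of a Lipschitz function against a compactly supported `C¹` vector field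
on `ℝⁿ`, where the differential of the Lipschitz function exists almost everywhere by
Rademacher's theorem. -/
theorem integral_mul_euclidean_div {u : EuclideanSpace ℝ (Fin n) → ℝ} {C : ℝ≥0}
    (hu : LipschitzWith C u) {W : Fin n → EuclideanSpace ℝ (Fin n) → ℝ}
    (hW : ∀ k, ContDiff ℝ 1 (W k)) (hWc : ∀ k, HasCompactSupport (W k)) :
    ∫ y, u y * ∑ k, partialDeriv k (W k) y = -∫ y, fderiv ℝ u y (∑ k, W k y • unitVec k) := by
  have hlip : ∀ k, ∃ D, LipschitzWith D (W k) := fun k ↦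
    (hW k).lipschitzWith_of_hasCompactSupport (hWc k) (by simp)
  have hld : ∀ k y, lineDeriv ℝ (W k) y (unitVec k) = partialDeriv k (W k) y := fun k y ↦
    (((hW k).differentiable (by simp)) y).lineDeriv_eq_fderiv
  have hparts : ∀ k, ∫ y, u y * partialDeriv k (W k) y =
      -∫ y, W k y * lineDeriv ℝ u y (unitVec k) := fun k ↦ by
    obtain ⟨D, hD⟩ := hlip k
    have h := hu.integral_lineDeriv_mul_eq (μ := volume) hD (hWc k) (unitVec k)
    simp only [lineDeriv_neg, hld] at h
    simp_rw [mul_comm (W k _), h, neg_mul, integral_neg, neg_neg, mul_comm (u _)]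
  have hi1 : ∀ k, Integrable fun y ↦ u y * partialDeriv k (W k) y := fun k ↦ by
    have hc : Continuous (partialDeriv k (W k)) :=
      ((hW k).continuous_fderiv (by simp)).clm_apply continuous_const
    refine (hu.continuous.mul hc).integrable_of_hasCompactSupport (HasCompactSupport.mul_left ?_)
    exact ((hWc k).fderiv_apply (𝕜 := ℝ) (unitVec k))
  have hi2 : ∀ k, Integrable fun y ↦ W k y * lineDeriv ℝ u y (unitVec k) := fun k ↦
    (hu.locallyIntegrable_lineDeriv (unitVec k)).integrable_smul_left_of_hasCompactSupport
      (hW k).continuous (hWc k)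
  simp_rw [Finset.mul_sum]
  rw [integral_finsetSum _ fun k _ ↦ hi1 k]
  simp_rw [hparts]
  rw [Finset.sum_neg_distrib, ← integral_finsetSum _ fun k _ ↦ hi2 k]
  congr 1
  refine integral_congr_ae ?_
  filter_upwards [hu.ae_differentiableAt (μ := volume)] with y hy
  simp only [map_sum, map_smul, smul_eq_mul]
  exact Finset.sum_congr rfl fun k _ ↦ by rw [hy.lineDeriv_eq_fderiv]

end Euclidean

/-! ### Locality and additivity of the divergence -/

section DivergenceLocal

open Set Filter

variable {n : ℕ} {M : Type*} [TopologicalSpace M] [ChartedSpace (EuclideanSpace ℝ (Fin n)) M]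
  [Bundle.RiemannianBundle (fun p : M ↦ TangentSpace (𝓡 n) p)]

theorem divergence_congr {X Y : ∀ p : M, TangentSpace (𝓡 n) p} {p : M}
    (h : ∀ᶠ q in 𝓝 p, X q = Y q) : divergence X p = divergence Y p := by
  have hev : ∀ᶠ y in 𝓝 (extChartAt (𝓡 n) p p), X ((extChartAt (𝓡 n) p).symm y) =
      Y ((extChartAt (𝓡 n) p).symm y) := by
    have hc := continuousAt_extChartAt_symm (I := 𝓡 n) p
    rw [ContinuousAt, extChartAt_to_inv] at hc
    exact hc.eventually h
  have hk : ∀ k, fieldComponent X p k =ᶠ[𝓝 (extChartAt (𝓡 n) p p)] fieldComponent Y p k :=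
    fun k ↦ hev.mono fun y hy ↦ by simp only [fieldComponent, hy]
  have h1 : ∀ k, fieldComponent X p k (extChartAt (𝓡 n) p p) =
      fieldComponent Y p k (extChartAt (𝓡 n) p p) := fun k ↦ (hk k).self_of_nhds
  have h2 : ∀ k i, partialDeriv i (fieldComponent X p k) (extChartAt (𝓡 n) p p) =
      partialDeriv i (fieldComponent Y p k) (extChartAt (𝓡 n) p p) := fun k i ↦ by
    rw [partialDeriv, partialDeriv, (hk k).fderiv_eq]
  simp only [divergence, chartDiv, lieMetricMatrix, Matrix.of_apply, h1, h2]

theorem divergence_eq_zero {X : ∀ p : M, TangentSpace (𝓡 n) p} {p : M}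
    (h : ∀ᶠ q in 𝓝 p, X q = 0) : divergence X p = 0 := by
  have h0 : ∀ k, fieldComponent (fun q : M ↦ (0 : TangentSpace (𝓡 n) q)) p k = fun _ ↦ 0 :=
    fun k ↦ funext fun y ↦ by
      have := (coframe (n := n) p ((extChartAt (𝓡 n) p).symm y)).map_zero
      exact congrArg (fun v : EuclideanSpace ℝ (Fin n) ↦ v k) this
  rw [divergence_congr (Y := fun q ↦ (0 : TangentSpace (𝓡 n) q)) h]
  simp [divergence, chartDiv, lieMetricMatrix, h0, partialDeriv]

variable [IsManifold (𝓡 n) ∞ M] [IsContMDiffRiemannianBundle (𝓡 n) ∞ (EuclideanSpace ℝ (Fin n))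
    (fun p : M ↦ TangentSpace (𝓡 n) p)]

/-- By Voss's formula the divergence depends linearly on the field. -/
theorem divergence_sum {ι : Type*} (s : Finset ι) {Y : ι → ∀ p : M, TangentSpace (𝓡 n) p}
    (hY : ∀ i, ContMDiff (𝓡 n) (𝓡 n).tangent ∞
      (fun p ↦ (⟨p, Y i p⟩ : TangentBundle (𝓡 n) M)))
    (hs : ContMDiff (𝓡 n) (𝓡 n).tangent ∞
      (fun p ↦ (⟨p, ∑ i ∈ s, Y i p⟩ : TangentBundle (𝓡 n) M))) (p : M) :
    divergence (fun q ↦ ∑ i ∈ s, Y i q) p = ∑ i ∈ s, divergence (Y i) p := by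
  have hp := mem_extChartAt_target (I := 𝓡 n) p
  have hpos := Real.sqrt_pos.2 (det_metricMatrix_pos hp)
  refine mul_left_cancel₀ hpos.ne' ?_
  simp only [divergence, Finset.mul_sum]
  simp only [sqrt_det_mul_chartDiv hs hp, fun i ↦ sqrt_det_mul_chartDiv (hY i) hp]
  rw [Finset.sum_comm]
  refine Finset.sum_congr rfl fun k _ ↦ ?_
  have h1 : densityComponent (fun q ↦ ∑ i ∈ s, Y i q) p k =
      fun y ↦ ∑ i ∈ s, densityComponent (Y i) p k y := funext fun y ↦ by
    have h2 : localField (fun q ↦ ∑ i ∈ s, Y i q) p y = ∑ i ∈ s, localField (Y i) p y :=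
      map_sum (coframe p ((extChartAt (𝓡 n) p).symm y))
        (fun i ↦ Y i ((extChartAt (𝓡 n) p).symm y)) s
    simp [densityComponent, h2, Finset.mul_sum]
  rw [h1, partialDeriv, fderiv_fun_sum fun i _ ↦ ((contDiffOn_densityComponent (hY i) k).contDiffAt
    ((isOpen_extChartAt_target p).mem_nhds hp)).differentiableAt (by simp), _root_.sum_apply]
  rfl

end DivergenceLocal

/-! ### Integration by parts in a chart -/

section Parts

open Set Filter MeasureTheory
open scoped NNReal

variable {n : ℕ} {M : Type*} [MetricSpace M] [ChartedSpace (EuclideanSpace ℝ (Fin n)) M]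
  [Bundle.RiemannianBundle (fun p : M ↦ TangentSpace (𝓡 n) p)] [IsManifold (𝓡 n) ∞ M]
  [IsContMDiffRiemannianBundle (𝓡 n) ∞ (EuclideanSpace ℝ (Fin n))
    (fun p : M ↦ TangentSpace (𝓡 n) p)]
  [IsRiemannianManifold (𝓡 n) M] [MeasurableSpace M] [BorelSpace M]

/-- Integration by parts for a `K`-Lipschitz function `f` and a vector field with compact support in
a chart ball. -/
theorem abs_integral_mul_divergence_le_of_chart {X : ∀ p : M, TangentSpace (𝓡 n) p}
    (hX : ContMDiff (𝓡 n) (𝓡 n).tangent ∞ (fun p ↦ (⟨p, X p⟩ : TangentBundle (𝓡 n) M)))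
    {x₀ : M} {B S : Set (EuclideanSpace ℝ (Fin n))} {C : ℝ≥0} (hBo : IsOpen B)
    (hB : B ⊆ (extChartAt (𝓡 n) x₀).target)
    (hC : LipschitzOnWith C (extChartAt (𝓡 n) x₀).symm B) (hS : IsCompact S) (hSB : S ⊆ B)
    (hX0 : ∀ p ∉ (extChartAt (𝓡 n) x₀).symm '' S, X p = 0)
    {f : M → ℝ} {K : ℝ≥0} (hf : LipschitzWith K f) :
    |∫ p, f p * divergence X p ∂(riemannianVolume n M)| ≤
      K * ∫ p, √(metricAt p (X p) (X p)) ∂(riemannianVolume n M) := by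
  set T := (extChartAt (𝓡 n) x₀).target with hT
  have hTo : IsOpen T := isOpen_extChartAt_target x₀
  have hTm : MeasurableSet T := hTo.measurableSet
  have hcs : ContinuousOn (extChartAt (𝓡 n) x₀).symm T := continuousOn_extChartAt_symm x₀
  have hST : S ⊆ T := hSB.trans hB
  have himg : IsClosed ((extChartAt (𝓡 n) x₀).symm '' S) :=
    (hS.image_of_continuousOn (hcs.mono hST)).isClosed
  have himgs : ∀ p ∉ (extChartAt (𝓡 n) x₀).source, p ∉ (extChartAt (𝓡 n) x₀).symm '' S := by
    rintro p hp ⟨y, hy, rfl⟩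
    exact hp ((extChartAt (𝓡 n) x₀).map_target (hST hy))
  have hXS : ∀ y ∈ T, y ∉ S → X ((extChartAt (𝓡 n) x₀).symm y) = 0 := fun y hy hyS ↦ by
    refine hX0 _ ?_
    rintro ⟨z, hz, hzy⟩
    exact hyS ((extChartAt (𝓡 n) x₀).symm.injOn (hST hz) hy hzy ▸ hz)
  -- the vector density `√(det g) X`, extended by zero to `ℝⁿ`
  set W : Fin n → EuclideanSpace ℝ (Fin n) → ℝ := fun k ↦ S.indicator (densityComponent X x₀ k)
    with hWdef
  have hWS : ∀ k, ∀ y ∉ S, W k y = 0 := fun k y hy ↦ indicator_of_notMem hy _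
  have hWT : ∀ k, ∀ y ∈ T, W k y = densityComponent X x₀ k y := fun k y hy ↦ by
    by_cases hyS : y ∈ S
    · exact indicator_of_mem hyS _
    · rw [hWS k y hyS]
      have : localField X x₀ y = 0 :=
        (congrArg (coframe x₀ ((extChartAt (𝓡 n) x₀).symm y)) (hXS y hy hyS)).trans (map_zero _)
      simp [densityComponent, this]
  have hWev : ∀ k, ∀ y ∉ S, W k =ᶠ[𝓝 y] fun _ ↦ 0 := fun k y hy ↦
    (hS.isClosed.isOpen_compl.eventually_mem hy).mono fun z hz ↦ hWS k z hz
  have hWpd0 : ∀ k, ∀ y ∉ S, partialDeriv k (W k) y = 0 := fun k y hy ↦ by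
    rw [partialDeriv, (hWev k y hy).fderiv_eq]; simp
  have hWpd : ∀ k, ∀ y ∈ T, partialDeriv k (W k) y = partialDeriv k (densityComponent X x₀ k) y :=
    fun k y hy ↦ by
      have : W k =ᶠ[𝓝 y] densityComponent X x₀ k :=
        (hTo.eventually_mem hy).mono fun z hz ↦ hWT k z hz
      rw [partialDeriv, this.fderiv_eq, partialDeriv]
  have hW : ∀ k, ContDiff ℝ 1 (W k) := fun k ↦ contDiff_iff_contDiffAt.2 fun y ↦ by
    by_cases hy : y ∈ T
    · refine (((contDiffOn_densityComponent hX k).contDiffAt (hTo.mem_nhds hy)).of_le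
        (by simp)).congr_of_eventuallyEq ?_
      exact (hTo.eventually_mem hy).mono fun z hz ↦ hWT k z hz
    · exact contDiffAt_const.congr_of_eventuallyEq (hWev k y fun h ↦ hy (hST h))
  have hWc : ∀ k, HasCompactSupport (W k) := fun k ↦ HasCompactSupport.intro hS (hWS k)
  -- the function `f` in the chart, extended to a Lipschitz function on `ℝⁿ`
  obtain ⟨u, hu, huB⟩ := (hf.comp_lipschitzOnWith hC).extend_real
  have huB' : ∀ y ∈ B, f ((extChartAt (𝓡 n) x₀).symm y) = u y := huB
  have hleft : ∫ p, f p * divergence X p ∂(riemannianVolume n M) =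
      ∫ y, u y * ∑ k, partialDeriv k (W k) y := by
    rw [integral_eq_integral_chart x₀ (f := fun p ↦ f p * divergence X p)
      (hf.continuous.mul (continuous_divergence hX)).aestronglyMeasurable, ← integral_indicator hTm]
    · refine integral_congr_ae (ae_of_all _ fun y ↦ ?_)
      by_cases hy : y ∈ T
      · simp only [indicator_of_mem hy]
        rw [divergence_chart_symm hX hy, mul_left_comm, sqrt_det_mul_chartDiv hX hy]
        simp only [hWpd _ y hy]
        by_cases hyB : y ∈ B
        · rw [huB' y hyB]
        · simp only [← hWpd _ y hy, hWpd0 _ y fun h ↦ hyB (hSB h)]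
          simp
      · simp only [indicator_of_notMem hy, hWpd0 _ y fun h ↦ hy (hST h)]
        simp
    · intro p hp
      rw [divergence_eq_zero, mul_zero]
      exact (himg.isOpen_compl.eventually_mem (himgs p hp)).mono fun q hq ↦ hX0 q hq
  set N : M → ℝ := fun p ↦ √(metricAt p (X p) (X p)) with hN
  have hNc : Continuous N := (continuous_metricAt_self hX).sqrt
  have hN0 : ∀ p, X p = 0 → N p = 0 := fun p hp ↦ by
    have : metricAt p (X p) (X p) = 0 := by
      rw [hp]; exact inner_zero_left (E := TangentSpace (𝓡 n) p) (0 : TangentSpace (𝓡 n) p)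
    simp [hN, this]
  set b : EuclideanSpace ℝ (Fin n) → ℝ := fun y ↦
    √(metricMatrix x₀ y).det * N ((extChartAt (𝓡 n) x₀).symm y) with hb
  have hright : ∫ p, N p ∂(riemannianVolume n M) = ∫ y, S.indicator b y := by
    rw [integral_eq_integral_chart x₀ hNc.aestronglyMeasurable
      (fun p hp ↦ hN0 p (hX0 p (himgs p hp))), ← integral_indicator hTm]
    refine integral_congr_ae (ae_of_all _ fun y ↦ ?_)
    by_cases hyS : y ∈ S
    · simp only [indicator_of_mem hyS, indicator_of_mem (hST hyS), hb]
    · rw [indicator_of_notMem hyS]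
      by_cases hy : y ∈ T
      · rw [indicator_of_mem hy, hN0 _ (hXS y hy hyS), mul_zero]
      · rw [indicator_of_notMem hy]
  have hbi : Integrable (S.indicator b) := by
    refine IntegrableOn.integrable_indicator (ContinuousOn.integrableOn_compact hS ?_)
      hS.measurableSet
    exact ((contDiffOn_sqrt_det x₀).continuousOn.mono hST).mul
      (hNc.comp_continuousOn (hcs.mono hST))
  rw [hleft, integral_mul_euclidean_div hu hW hWc, abs_neg, hright, ← integral_const_mul,
    ← Real.norm_eq_abs]
  refine norm_integral_le_of_norm_le (hbi.const_mul _) ?_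
  filter_upwards [hu.ae_differentiableAt (μ := volume)] with y hd
  by_cases hyS : y ∈ S
  · have hy := hST hyS
    have hev : u =ᶠ[𝓝 y] f ∘ (extChartAt (𝓡 n) x₀).symm :=
      (hBo.eventually_mem (hSB hyS)).mono fun z hz ↦ (huB' z hz).symm
    have hsum : ∑ k, W k y • unitVec k = √(metricMatrix x₀ y).det • localField X x₀ y := by
      simp only [hWT _ y hy, densityComponent, mul_smul]
      rw [← Finset.smul_sum, sum_unitVec]
    have hle := abs_fderiv_comp_chart_symm_le hf hy (hd.congr_of_eventuallyEq hev.symm)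
      (localField X x₀ y)
    rw [indicator_of_mem hyS, hsum, map_smul, smul_eq_mul, norm_mul, Real.norm_eq_abs,
      Real.norm_eq_abs, abs_of_nonneg (Real.sqrt_nonneg _), hev.fderiv_eq, hb]
    simp only [hN]
    rw [metricAt_self_chart_symm X hy, mul_left_comm]
    exact mul_le_mul_of_nonneg_left hle (Real.sqrt_nonneg _)
  · simp [hWS _ y hyS, indicator_of_notMem hyS]

end Parts

/-! ### The trace of the quasi Einstein equation -/

section Trace

variable {n : ℕ} {M : Type*} [TopologicalSpace M] [ChartedSpace (EuclideanSpace ℝ (Fin n)) M]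
  [IsManifold (𝓡 n) ∞ M]

theorem formOfMatrix_frame (A : Matrix (Fin n) (Fin n) ℝ) (p : M) (i j : Fin n) :
    formOfMatrix A p (frame p (extChartAt (𝓡 n) p p) (unitVec i))
      (frame p (extChartAt (𝓡 n) p p) (unitVec j)) = A i j := by
  have h : ∀ v, components p p (frame p (extChartAt (𝓡 n) p p) v) = v := fun v ↦ by
    have := coframe_frame (mem_extChartAt_target (I := 𝓡 n) p) v
    rwa [extChartAt_to_inv] at this
  simp only [formOfMatrix, h]
  simp [unitVec]

theorem sum_inv_mul_self {G : Matrix (Fin n) (Fin n) ℝ} (hG : IsUnit G.det)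
    (hs : ∀ i j, G i j = G j i) : ∑ i, ∑ j, G⁻¹ i j * G i j = n := by
  have h : ∀ i, ∑ j, G⁻¹ i j * G i j = 1 := fun i ↦ by
    have := congrFun (congrFun (Matrix.nonsing_inv_mul G hG) i) i
    rw [Matrix.mul_apply, Matrix.one_apply_eq] at this
    rw [← this]
    exact Finset.sum_congr rfl fun j _ ↦ by rw [hs]
  simp [h]

/-- For `G` the metric and `x` the components of a vector, this says that the trace of `X♭ ⊗ X♭` is
`|X|²`. -/
theorem sum_inv_mul_mul {G : Matrix (Fin n) (Fin n) ℝ} (hG : IsUnit G.det) (x : Fin n → ℝ) :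
    ∑ i, ∑ j, G⁻¹ i j * ((G.mulVec x) i * (G.mulVec x) j) = ∑ i, (G.mulVec x) i * x i := by
  have h : ∀ i, ∑ j, G⁻¹ i j * (G.mulVec x) j = x i := fun i ↦ by
    have : (G⁻¹.mulVec (G.mulVec x)) i = x i := by
      rw [Matrix.mulVec_mulVec, Matrix.nonsing_inv_mul G hG, Matrix.one_mulVec]
    exact this
  refine Finset.sum_congr rfl fun i _ ↦ ?_
  conv_rhs => rw [← h i, Finset.mul_sum]
  exact Finset.sum_congr rfl fun j _ ↦ by ring

variable [Bundle.RiemannianBundle (fun p : M ↦ TangentSpace (𝓡 n) p)]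

/-- The trace of the quasi Einstein equation. -/
theorem IsQuasiEinstein.trace {m : ENNReal} {c : ℝ} {X : ∀ p : M, TangentSpace (𝓡 n) p}
    (hX : IsQuasiEinstein m c X) (p : M) :
    c * n - scalarCurvature n p =
      divergence X p - (m⁻¹).toReal * metricAt p (X p) (X p) := by
  set y := extChartAt (𝓡 n) p p with hy
  have hyT : y ∈ (extChartAt (𝓡 n) p).target := mem_extChartAt_target p
  have hyp : (extChartAt (𝓡 n) p).symm y = p := extChartAt_to_inv p
  set G := metricMatrix p y with hG
  have hGu : IsUnit G.det := (det_metricMatrix_pos hyT).ne'.isUnit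
  have hmet : ∀ v w, metricAt p (frame p y v) (frame p y w) = ∑ i, ∑ j, G i j * v i * w j :=
    fun v w ↦ by rw [← metricAt_frame, hyp]
  set x : Fin n → ℝ := fun k ↦ localField X p y k with hx
  have hXp : (X p : EuclideanSpace ℝ (Fin n)) = frame p y (localField X p y) := by
    have h1 := frame_localField X hyT
    exact (h1.trans (congrArg (fun q ↦ (X q : EuclideanSpace ℝ (Fin n))) hyp)).symm
  have hlow : ∀ a, metricAt p (X p) (frame p y (unitVec a)) = G.mulVec x a := fun a ↦ by
    rw [hXp, metricAt_comm, hmet]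
    simp [unitVec, Matrix.mulVec, dotProduct, hx]
  have hnorm : metricAt p (X p) (X p) = ∑ i, G.mulVec x i * x i := by
    rw [hXp, hmet]
    refine Finset.sum_congr rfl fun i _ ↦ ?_
    simp only [Matrix.mulVec, dotProduct, Finset.sum_mul, hx]
    exact Finset.sum_congr rfl fun j _ ↦ by ring
  have hentry : ∀ a b, ricciMatrix p y a b + (1 / 2) * lieMetricMatrix X p y a b
      - (m⁻¹).toReal * (G.mulVec x a * G.mulVec x b) = c * G a b := fun a b ↦ by
    have h := hX.equation p (frame p y (unitVec a)) (frame p y (unitVec b))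
    have h1 := formOfMatrix_frame (ricciMatrix p y) p a b
    have h2 := formOfMatrix_frame (lieMetricMatrix X p y) p a b
    have h3 : metricAt p (frame p y (unitVec a)) (frame p y (unitVec b)) = G a b := by
      rw [hG, metricMatrix_eq, hyp]
    rw [← h1, ← h2, ← hlow a, ← hlow b, ← h3]
    exact h
  have hsum : ∑ a, ∑ b, G⁻¹ a b * (ricciMatrix p y a b + (1 / 2) * lieMetricMatrix X p y a b
      - (m⁻¹).toReal * (G.mulVec x a * G.mulVec x b)) = ∑ a, ∑ b, G⁻¹ a b * (c * G a b) := by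
    simp only [hentry]
  have e1 : ∀ a b, G⁻¹ a b * (ricciMatrix p y a b + (1 / 2) * lieMetricMatrix X p y a b
      - (m⁻¹).toReal * (G.mulVec x a * G.mulVec x b)) =
      G⁻¹ a b * ricciMatrix p y a b + (1 / 2) * (G⁻¹ a b * lieMetricMatrix X p y a b)
      - (m⁻¹).toReal * (G⁻¹ a b * (G.mulVec x a * G.mulVec x b)) := fun a b ↦ by ring
  have e2 : ∀ a b, G⁻¹ a b * (c * G a b) = c * (G⁻¹ a b * G a b) := fun a b ↦ by ring
  simp only [e1, e2, Finset.sum_sub_distrib, Finset.sum_add_distrib, ← Finset.mul_sum] at hsum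
  rw [sum_inv_mul_self hGu (metricMatrix_symm p y), sum_inv_mul_mul hGu, ← hnorm] at hsum
  have h4 : scalarCurvature n p = ∑ a, ∑ b, G⁻¹ a b * ricciMatrix p y a b := rfl
  have h5 : divergence X p = 1 / 2 * ∑ a, ∑ b, G⁻¹ a b * lieMetricMatrix X p y a b := rfl
  linarith

end Trace

/-! ### Integration by parts on the manifold -/

section GlobalParts

open Set Filter MeasureTheory
open scoped NNReal

variable {n : ℕ} {M : Type*} [MetricSpace M] [ChartedSpace (EuclideanSpace ℝ (Fin n)) M]
  [Bundle.RiemannianBundle (fun p : M ↦ TangentSpace (𝓡 n) p)] [IsManifold (𝓡 n) ∞ M]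
  [IsContMDiffRiemannianBundle (𝓡 n) ∞ (EuclideanSpace ℝ (Fin n))
    (fun p : M ↦ TangentSpace (𝓡 n) p)]
  [IsRiemannianManifold (𝓡 n) M] [MeasurableSpace M] [BorelSpace M]

/-- Integration by parts on `M`: if `f` is `K`-Lipschitz with compact support, then
`|∫ f div X| ≤ K ∫ |X|`. A partition of unity reduces this to fields supported in chart balls. -/
theorem abs_integral_mul_divergence_le [SigmaCompactSpace M]
    [IsFiniteMeasure (riemannianVolume n M)] {X : ∀ p : M, TangentSpace (𝓡 n) p}
    (hX : ContMDiff (𝓡 n) (𝓡 n).tangent ∞ (fun p ↦ (⟨p, X p⟩ : TangentBundle (𝓡 n) M)))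
    (hXi : Integrable (fun p ↦ √(metricAt p (X p) (X p))) (riemannianVolume n M))
    {f : M → ℝ} {K : ℝ≥0} (hf : LipschitzWith K f) (hfc : HasCompactSupport f) :
    |∫ p, f p * divergence X p ∂(riemannianVolume n M)| ≤
      K * ∫ p, √(metricAt p (X p) (X p)) ∂(riemannianVolume n M) := by
  choose r hr C hball hC using exists_ball_lipschitzOn_chart_symm (n := n) (M := M)
  let U : M → Set M := fun x ↦ (extChartAt (𝓡 n) x).source ∩
    extChartAt (𝓡 n) x ⁻¹' Metric.ball (extChartAt (𝓡 n) x x) (r x / 2)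
  have hUo : ∀ x, IsOpen (U x) := fun x ↦
    (continuousOn_extChartAt x).isOpen_inter_preimage (isOpen_extChartAt_source x)
      Metric.isOpen_ball
  obtain ⟨ρ, hρ⟩ := SmoothPartitionOfUnity.exists_isSubordinate (𝓡 n) (isClosed_univ (X := M))
    U hUo fun x _ ↦ mem_iUnion.2 ⟨x, mem_extChartAt_source x,
      Metric.mem_ball_self (half_pos (hr x))⟩
  -- only finitely many members of the partition of unity meet the support of `f`
  have hfin : {i | (Function.support (ρ i) ∩ tsupport f).Nonempty}.Finite :=
    ρ.locallyFinite.finite_nonempty_inter_compact hfc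
  set F := hfin.toFinset with hF
  -- on the support of `f` these members suffice, so there `X` is the sum of the fields `ρ i • X`
  have hsum1 : ∀ p ∈ tsupport f, ∑ i ∈ F, ρ i p = 1 := fun p hp ↦ by
    refine ρ.sum_finsupport' p (mem_univ p) fun i hi ↦ ?_
    rw [hF, Set.Finite.mem_toFinset]
    exact ⟨p, (ρ.mem_finsupport p).1 hi, hp⟩
  have hsum_le : ∀ p, ∑ i ∈ F, ρ i p ≤ 1 := fun p ↦ by
    classical
    calc ∑ i ∈ F, ρ i p ≤ ∑ i ∈ F ∪ ρ.finsupport p, ρ i p :=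
          Finset.sum_le_sum_of_subset_of_nonneg Finset.subset_union_left
            fun i _ _ ↦ ρ.nonneg i p
      _ = 1 := ρ.sum_finsupport' p (mem_univ p) Finset.subset_union_right
  let Y : M → ∀ p : M, TangentSpace (𝓡 n) p := fun i p ↦ ρ i p • X p
  have hY : ∀ i, ContMDiff (𝓡 n) (𝓡 n).tangent ∞
      (fun p ↦ (⟨p, Y i p⟩ : TangentBundle (𝓡 n) M)) := fun i ↦
    ContMDiff.smul_section (ρ i).contMDiff hX
  have hYs : ContMDiff (𝓡 n) (𝓡 n).tangent ∞
      (fun p ↦ (⟨p, ∑ i ∈ F, Y i p⟩ : TangentBundle (𝓡 n) M)) :=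
    ContMDiff.sum_section fun i _ ↦ hY i
  have hnorm : ∀ i p, √(metricAt p (Y i p) (Y i p)) = ρ i p * √(metricAt p (X p) (X p)) :=
    fun i p ↦ by
      have h1 : metricAt p (Y i p) (Y i p) = ρ i p ^ 2 * metricAt p (X p) (X p) := by
        have h2 := metricAt_smul_left p (ρ i p) (X p) (Y i p)
        have h3 := metricAt_smul_right p (ρ i p) (X p) (X p)
        refine h2.trans ?_
        rw [sq, mul_assoc]
        exact congrArg _ h3
      rw [h1, Real.sqrt_mul (sq_nonneg _), Real.sqrt_sq (ρ.nonneg i p)]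
  -- the identity is needed only where `f p ≠ 0`, an open set on which `X = ∑ i ∈ F, Y i`
  have hdiv : ∀ p, f p * divergence X p = ∑ i ∈ F, f p * divergence (Y i) p := fun p ↦ by
    by_cases hp : f p = 0
    · simp [hp]
    · rw [← Finset.mul_sum, ← divergence_sum F hY hYs]
      congr 1
      have hev : ∀ᶠ q in 𝓝 p, q ∈ tsupport f :=
        (hf.continuous.continuousAt.eventually_ne hp).mono fun q hq ↦ subset_tsupport f hq
      refine divergence_congr (hev.mono fun q hq ↦ ?_)
      have h1 : ∑ i ∈ F, Y i q = (∑ i ∈ F, ρ i q) • X q := (Finset.sum_smul).symm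
      rw [h1, hsum1 q hq, one_smul]
  have hint : ∀ i, Integrable (fun p ↦ f p * divergence (Y i) p) (riemannianVolume n M) :=
    fun i ↦ (hf.continuous.mul (continuous_divergence (hY i))).integrable_of_hasCompactSupport
      hfc.mul_right
  have hinti : ∀ i, Integrable (fun p ↦ ρ i p * √(metricAt p (X p) (X p)))
      (riemannianVolume n M) := fun i ↦ by
    refine hXi.mono' (((ρ i).contMDiff.continuous.mul
      (continuous_metricAt_self hX).sqrt).aestronglyMeasurable) (ae_of_all _ fun p ↦ ?_)
    rw [Real.norm_eq_abs, abs_of_nonneg (mul_nonneg (ρ.nonneg i p) (Real.sqrt_nonneg _))]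
    exact mul_le_of_le_one_left (Real.sqrt_nonneg _) (ρ.le_one i p)
  have hloc : ∀ i, |∫ p, f p * divergence (Y i) p ∂(riemannianVolume n M)| ≤
      K * ∫ p, ρ i p * √(metricAt p (X p) (X p)) ∂(riemannianVolume n M) := fun i ↦ by
    have h := abs_integral_mul_divergence_le_of_chart (hY i) Metric.isOpen_ball (hball i) (hC i)
      (isCompact_closedBall (extChartAt (𝓡 n) i i) (r i / 2))
      (Metric.closedBall_subset_ball (half_lt_self (hr i))) (fun p hp ↦ ?_) hf
    · simpa only [hnorm] using h
    · have hρ0 : ρ i p = 0 := by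
        by_contra hne
        have hpU : p ∈ U i := hρ i (subset_tsupport _ hne)
        exact hp ⟨_, Metric.ball_subset_closedBall hpU.2, (extChartAt (𝓡 n) i).left_inv hpU.1⟩
      have : ρ i p • X p = 0 := by rw [hρ0, zero_smul]
      exact this
  simp_rw [hdiv]
  rw [integral_finsetSum _ fun i _ ↦ hint i]
  calc _ ≤ ∑ i ∈ F, |∫ p, f p * divergence (Y i) p ∂(riemannianVolume n M)| :=
        Finset.abs_sum_le_sum_abs _ _
    _ ≤ ∑ i ∈ F, K * ∫ p, ρ i p * √(metricAt p (X p) (X p)) ∂(riemannianVolume n M) :=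
        Finset.sum_le_sum fun i _ ↦ hloc i
    _ = K * ∫ p, ∑ i ∈ F, ρ i p * √(metricAt p (X p) (X p)) ∂(riemannianVolume n M) := by
        rw [integral_finsetSum _ fun i _ ↦ hinti i, Finset.mul_sum]
    _ ≤ _ := by
        refine mul_le_mul_of_nonneg_left (integral_mono
          (integrable_finsetSum _ fun i _ ↦ hinti i) hXi fun p ↦ ?_) K.2
        simp only [← Finset.sum_mul]
        exact mul_le_of_le_one_left (Real.sqrt_nonneg _) (hsum_le p)

end GlobalParts

/-! ### Cutoff functions and weighted integrals -/

section Cutoff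

open Set Filter MeasureTheory
open scoped NNReal

/-- Let `0 ≤ w k ≤ 1`, `w k → 1` pointwise, and suppose that the weighted integrals of `g` converge
to `L`. If the positive part of `g` has finite integral, then so has the negative part, by Fatou's
lemma, and `∫ g = L` by dominated convergence. -/
theorem integrable_and_integral_eq_of_tendsto_weighted {α : Type*} [MeasurableSpace α]
    {μ : Measure α} {g : α → ℝ} (hg : AEStronglyMeasurable g μ) {w : ℕ → α → ℝ}
    (hw : ∀ k, AEStronglyMeasurable (w k) μ) (hw0 : ∀ k x, 0 ≤ w k x) (hw1 : ∀ k x, w k x ≤ 1)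
    (hwt : ∀ x, Tendsto (fun k ↦ w k x) atTop (𝓝 1))
    (hi : ∀ k, Integrable (fun x ↦ w k x * g x) μ) {L : ℝ}
    (hL : Tendsto (fun k ↦ ∫ x, w k x * g x ∂μ) atTop (𝓝 L))
    (hpos : ∫⁻ x, ENNReal.ofReal (g x) ∂μ < ⊤) : Integrable g μ ∧ ∫ x, g x ∂μ = L := by
  -- dominated convergence for the weights
  have hdom : ∀ f : α → ℝ, Integrable f μ →
      (∀ k, Integrable (fun x ↦ w k x * f x) μ) ∧
      Tendsto (fun k ↦ ∫ x, w k x * f x ∂μ) atTop (𝓝 (∫ x, f x ∂μ)) := fun f hf ↦ by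
    have hb : ∀ k x, ‖w k x * f x‖ ≤ ‖f x‖ := fun k x ↦ by
      rw [norm_mul, Real.norm_of_nonneg (hw0 k x)]
      exact mul_le_of_le_one_left (norm_nonneg _) (hw1 k x)
    refine ⟨fun k ↦ hf.mono ((hw k).mul hf.1) (ae_of_all _ (hb k)),
      tendsto_integral_of_dominated_convergence (fun x ↦ ‖f x‖) (fun k ↦ (hw k).mul hf.1)
      hf.norm (fun k ↦ ae_of_all _ (hb k)) (ae_of_all _ fun x ↦ ?_)⟩
    simpa using (hwt x).mul_const (f x)
  have hp : Integrable (fun x ↦ max (g x) 0) μ := by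
    refine ⟨hg.sup aestronglyMeasurable_const, ?_⟩
    rw [hasFiniteIntegral_iff_ofReal (f := fun x ↦ max (g x) 0)
      (ae_of_all _ fun x ↦ le_max_right _ _)]
    simpa [ENNReal.ofReal_max] using hpos
  have hsplit : ∀ x, max (-g x) 0 = max (g x) 0 - g x := fun x ↦ by
    rcases le_total (g x) 0 with h | h
    · rw [max_eq_left (by linarith), max_eq_right h]; ring
    · rw [max_eq_right (by linarith), max_eq_left h]; ring
  obtain ⟨hpi, hpt⟩ := hdom _ hp
  have hni : ∀ k, Integrable (fun x ↦ w k x * max (-g x) 0) μ := fun k ↦ by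
    simp only [hsplit, mul_sub]
    exact (hpi k).sub (hi k)
  have hnt : Tendsto (fun k ↦ ∫ x, w k x * max (-g x) 0 ∂μ) atTop
      (𝓝 (∫ x, max (g x) 0 ∂μ - L)) := by
    simp only [hsplit, mul_sub]
    simp_rw [fun k ↦ integral_sub (hpi k) (hi k)]
    exact hpt.sub hL
  have hn : Integrable (fun x ↦ max (-g x) 0) μ := by
    refine ⟨hg.neg.sup aestronglyMeasurable_const, ?_⟩
    rw [hasFiniteIntegral_iff_ofReal (f := fun x ↦ max (-g x) 0)
      (ae_of_all _ fun x ↦ le_max_right _ _)]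
    have hlim : ∀ x, liminf (fun k ↦ ENNReal.ofReal (w k x * max (-g x) 0)) atTop =
        ENNReal.ofReal (max (-g x) 0) := fun x ↦ by
      refine Tendsto.liminf_eq (ENNReal.tendsto_ofReal ?_)
      simpa using (hwt x).mul_const (max (-g x) 0)
    calc ∫⁻ x, ENNReal.ofReal (max (-g x) 0) ∂μ
        = ∫⁻ x, liminf (fun k ↦ ENNReal.ofReal (w k x * max (-g x) 0)) atTop ∂μ := by
          simp only [hlim]
      _ ≤ liminf (fun k ↦ ∫⁻ x, ENNReal.ofReal (w k x * max (-g x) 0) ∂μ) atTop :=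
          lintegral_liminf_le' fun k ↦ (hni k).1.aemeasurable.ennreal_ofReal
      _ = ENNReal.ofReal (∫ x, max (g x) 0 ∂μ - L) := by
          refine Tendsto.liminf_eq ?_
          simp_rw [← fun k ↦ ofReal_integral_eq_lintegral_ofReal (hni k)
            (ae_of_all _ fun x ↦ mul_nonneg (hw0 k x) (le_max_right _ _))]
          exact ENNReal.tendsto_ofReal hnt
      _ < ⊤ := ENNReal.ofReal_lt_top
  have hgi : Integrable g μ := by
    refine (hp.sub hn).congr (ae_of_all _ fun x ↦ ?_)
    simp only [Pi.sub_apply, hsplit]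
    ring
  exact ⟨hgi, tendsto_nhds_unique (hdom g hgi).2 hL⟩

variable {M : Type*} [MetricSpace M]

/-- The cutoff function that equals `1` on the ball of radius `r` around `p` and `0` outside the
ball of radius `2 r`. -/
noncomputable def cutoff (p : M) (r : ℝ) (x : M) : ℝ := max 0 (min 1 (2 - dist x p / r))

theorem cutoff_nonneg (p : M) (r : ℝ) (x : M) : 0 ≤ cutoff p r x := le_max_left _ _

theorem cutoff_le_one (p : M) (r : ℝ) (x : M) : cutoff p r x ≤ 1 :=
  max_le zero_le_one (min_le_left _ _)

theorem lipschitzWith_cutoff (p : M) {r : ℝ} (hr : 0 < r) :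
    LipschitzWith (r⁻¹).toNNReal (cutoff p r) := by
  have h : LipschitzWith (r⁻¹).toNNReal fun x ↦ 2 - dist x p / r := by
    refine LipschitzWith.of_dist_le_mul fun x y ↦ ?_
    rw [Real.coe_toNNReal _ (inv_nonneg.2 hr.le), Real.dist_eq]
    have h1 : 2 - dist x p / r - (2 - dist y p / r) = r⁻¹ * (dist y p - dist x p) := by
      field_simp; ring
    rw [h1, abs_mul, abs_of_pos (inv_pos.2 hr)]
    refine mul_le_mul_of_nonneg_left ?_ (inv_nonneg.2 hr.le)
    rw [dist_comm x y]
    exact abs_dist_sub_le y x p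
  exact (h.const_min 1).const_max 0

theorem hasCompactSupport_cutoff [ProperSpace M] (p : M) {r : ℝ} (hr : 0 < r) :
    HasCompactSupport (cutoff p r) := by
  refine HasCompactSupport.intro (isCompact_closedBall p (2 * r)) fun x hx ↦ ?_
  rw [Metric.mem_closedBall, not_le] at hx
  refine max_eq_left ((min_le_right _ _).trans ?_)
  rw [sub_nonpos, le_div_iff₀ hr]
  exact hx.le

theorem tendsto_cutoff (p x : M) : Tendsto (fun r ↦ cutoff p r x) atTop (𝓝 1) := by
  refine tendsto_const_nhds.congr' ?_
  filter_upwards [eventually_ge_atTop (dist x p), eventually_gt_atTop 0] with r hr hr0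
  have h : dist x p / r ≤ 1 := (div_le_one hr0).2 hr
  rw [cutoff, min_eq_left (by linarith), max_eq_right zero_le_one]

end Cutoff

end QuasiEinstein

/-! ### The integral of `c n - R` -/

open QuasiEinstein in
open MeasureTheory Filter in
theorem mainTheorem4
    (n : ℕ) (hn : 2 < n)
    (M : Type*) [MetricSpace M] [SecondCountableTopology M]
    [ChartedSpace (EuclideanSpace ℝ (Fin n)) M] [IsManifold (𝓡 n) ∞ M]
    [Bundle.RiemannianBundle (fun p : M ↦ TangentSpace (𝓡 n) p)]
    [IsContMDiffRiemannianBundle (𝓡 n) ∞ (EuclideanSpace ℝ (Fin n))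
      (fun p : M ↦ TangentSpace (𝓡 n) p)]
    [IsRiemannianManifold (𝓡 n) M]
    [MeasurableSpace M] [BorelSpace M]
    [CompleteSpace M] [NoncompactSpace M]
    (m : ENNReal) (c : ℝ) (X : ∀ p : M, TangentSpace (𝓡 n) p)
    (hX : QuasiEinstein.IsQuasiEinstein m c X) (hc : 0 ≤ c)
    (hvol : QuasiEinstein.riemannianVolume n M Set.univ < ⊤)
    (hL2 : ∫⁻ p, ENNReal.ofReal (inner ℝ (X p) (X p)) ∂(QuasiEinstein.riemannianVolume n M) < ⊤) :
    (∀ p : M, ∃ L : ℝ, L ≤ 0 ∧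
      Filter.Tendsto
        (fun r : ℝ ↦ ∫ x, max 0 (min 1 (2 - dist x p / r)) *
          (c * n - QuasiEinstein.scalarCurvature n x) ∂(QuasiEinstein.riemannianVolume n M))
        Filter.atTop (𝓝 L)) ∧
    ((∫⁻ x, ENNReal.ofReal (c * n - QuasiEinstein.scalarCurvature n x)
          ∂(QuasiEinstein.riemannianVolume n M) < ⊤ ∨
      ∫⁻ x, ENNReal.ofReal (QuasiEinstein.scalarCurvature n x - c * n)
          ∂(QuasiEinstein.riemannianVolume n M) < ⊤) →
      MeasureTheory.Integrable (fun x ↦ c * n - QuasiEinstein.scalarCurvature n x)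
          (QuasiEinstein.riemannianVolume n M) ∧
      ∫ x, (c * n - QuasiEinstein.scalarCurvature n x)
          ∂(QuasiEinstein.riemannianVolume n M) ≤ 0) ∧
    ∃ (p : M) (r : ℝ), 0 < r ∧
      ∀ x ∈ Metric.ball p r, c * n ≤ QuasiEinstein.scalarCurvature n x := by
  have : ProperSpace M := properSpace_of_complete n M
  have : IsFiniteMeasure (riemannianVolume n M) := ⟨hvol⟩
  set μ := riemannianVolume n M with hμ
  set a := (m⁻¹).toReal with ha
  have ha0 : 0 ≤ a := ENNReal.toReal_nonneg
  set g : M → ℝ := fun x ↦ c * n - scalarCurvature n x with hg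
  have hN2c : Continuous fun p ↦ metricAt p (X p) (X p) := continuous_metricAt_self hX.smooth
  have hg_eq : ∀ p, g p = divergence X p - a * metricAt p (X p) (X p) := hX.trace
  have hgc : Continuous g := by
    rw [funext hg_eq]
    exact (continuous_divergence hX.smooth).sub (continuous_const.mul hN2c)
  have hN2i : Integrable (fun p ↦ metricAt p (X p) (X p)) μ := by
    refine ⟨hN2c.aestronglyMeasurable, ?_⟩
    rw [hasFiniteIntegral_iff_ofReal (ae_of_all _ fun p ↦ metricAt_self_nonneg p (X p))]
    exact hL2
  -- finite volume turns the bound on `|X|²` into one on `|X|`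
  have hNi : Integrable (fun p ↦ √(metricAt p (X p) (X p))) μ := by
    refine ((integrable_const (1 : ℝ)).add hN2i).mono' hN2c.sqrt.aestronglyMeasurable
      (ae_of_all _ fun p ↦ ?_)
    rw [Real.norm_of_nonneg (Real.sqrt_nonneg _), Pi.add_apply]
    nlinarith [Real.sq_sqrt (metricAt_self_nonneg p (X p)),
      sq_nonneg (√(metricAt p (X p) (X p)) - 1)]
  have hcut : ∀ (p : M) (r : ℝ), 0 < r → Continuous (cutoff p r) := fun p r hr ↦
    (lipschitzWith_cutoff p hr).continuous
  have hcutg : ∀ (p : M) (r : ℝ), 0 < r → ∀ h : M → ℝ, Continuous h →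
      Integrable (fun x ↦ cutoff p r x * h x) μ := fun p r hr h hh ↦
    ((hcut p r hr).mul hh).integrable_of_hasCompactSupport
      (hasCompactSupport_cutoff p hr).mul_right
  have hlim : ∀ p : M, Tendsto (fun r ↦ ∫ x, cutoff p r x * g x ∂μ) atTop
      (𝓝 (-(a * ∫ x, metricAt x (X x) (X x) ∂μ))) := fun p ↦ by
    -- the cutoff function is `1 / r`-Lipschitz
    have h1 : Tendsto (fun r ↦ ∫ x, cutoff p r x * divergence X x ∂μ) atTop (𝓝 0) := by
      have hz : Tendsto (fun r : ℝ ↦ r⁻¹ * ∫ x, √(metricAt x (X x) (X x)) ∂μ) atTop (𝓝 0) := by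
        simpa using tendsto_inv_atTop_zero.mul_const (∫ x, √(metricAt x (X x) (X x)) ∂μ)
      refine squeeze_zero_norm' ?_ hz
      filter_upwards [eventually_gt_atTop 0] with r hr
      have h := abs_integral_mul_divergence_le hX.smooth hNi (lipschitzWith_cutoff p hr)
        (hasCompactSupport_cutoff p hr)
      rwa [Real.coe_toNNReal _ (inv_nonneg.2 hr.le)] at h
    have h2 : Tendsto (fun r ↦ ∫ x, cutoff p r x * metricAt x (X x) (X x) ∂μ) atTop
        (𝓝 (∫ x, metricAt x (X x) (X x) ∂μ)) := by
      refine tendsto_integral_filter_of_dominated_convergence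
        (fun x ↦ metricAt x (X x) (X x)) ?_ (Eventually.of_forall fun r ↦ ae_of_all _ fun x ↦ ?_)
        hN2i (ae_of_all _ fun x ↦ ?_)
      · filter_upwards [eventually_gt_atTop 0] with r hr
        exact ((hcut p r hr).mul hN2c).aestronglyMeasurable
      · rw [Real.norm_of_nonneg (mul_nonneg (cutoff_nonneg p r x) (metricAt_self_nonneg x (X x)))]
        exact mul_le_of_le_one_left (metricAt_self_nonneg x (X x)) (cutoff_le_one p r x)
      · simpa using (tendsto_cutoff p x).mul_const (metricAt x (X x) (X x))
    have h3 := h1.sub (h2.const_mul a)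
    rw [zero_sub] at h3
    refine h3.congr' ?_
    filter_upwards [eventually_gt_atTop 0] with r hr
    rw [← integral_const_mul, ← integral_sub (hcutg p r hr _ (continuous_divergence hX.smooth))
      ((hcutg p r hr _ hN2c).const_mul a)]
    refine integral_congr_ae (ae_of_all _ fun x ↦ ?_)
    simp only [hg_eq]
    ring
  have hL0 : -(a * ∫ x, metricAt x (X x) (X x) ∂μ) ≤ 0 :=
    neg_nonpos.2 (mul_nonneg ha0 (integral_nonneg fun x ↦ metricAt_self_nonneg x (X x)))
  have : Nonempty M := by
    by_contra hne
    rw [not_nonempty_iff] at hne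
    exact not_compactSpace_iff.2 (inferInstance : NoncompactSpace M) inferInstance
  obtain ⟨p₀⟩ := this
  have hint : (∫⁻ x, ENNReal.ofReal (g x) ∂μ < ⊤ ∨ ∫⁻ x, ENNReal.ofReal (-g x) ∂μ < ⊤) →
      Integrable g μ ∧ ∫ x, g x ∂μ ≤ 0 := by
    have hk : ∀ k : ℕ, (0 : ℝ) < k + 1 := fun k ↦ k.cast_add_one_pos
    have hkt : Tendsto (fun k : ℕ ↦ (k : ℝ) + 1) atTop atTop :=
      tendsto_atTop_add_const_right _ _ tendsto_natCast_atTop_atTop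
    have hw : ∀ k : ℕ, AEStronglyMeasurable (cutoff p₀ ((k : ℝ) + 1)) μ := fun k ↦
      (hcut p₀ _ (hk k)).aestronglyMeasurable
    have hlk := (hlim p₀).comp hkt
    rintro (h | h)
    · obtain ⟨h1, h2⟩ := integrable_and_integral_eq_of_tendsto_weighted
        hgc.aestronglyMeasurable hw (fun k ↦ cutoff_nonneg p₀ _) (fun k ↦ cutoff_le_one p₀ _)
        (fun x ↦ (tendsto_cutoff p₀ x).comp hkt) (fun k ↦ hcutg p₀ _ (hk k) g hgc) hlk h
      exact ⟨h1, h2.trans_le hL0⟩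
    · obtain ⟨h1, h2⟩ := integrable_and_integral_eq_of_tendsto_weighted (g := fun x ↦ -g x)
        hgc.neg.aestronglyMeasurable hw (fun k ↦ cutoff_nonneg p₀ _) (fun k ↦ cutoff_le_one p₀ _)
        (fun x ↦ (tendsto_cutoff p₀ x).comp hkt) (fun k ↦ hcutg p₀ _ (hk k) _ hgc.neg)
        (L := a * ∫ x, metricAt x (X x) (X x) ∂μ)
        (by simpa [Function.comp_def, integral_neg] using hlk.neg) h
      rw [integral_neg] at h2
      exact ⟨by simpa using h1.neg, by linarith⟩
  refine ⟨fun p ↦ ⟨_, hL0, hlim p⟩, fun h ↦ hint ?_, ?_⟩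
  · simpa only [hg, neg_sub] using h
  · by_contra! hcon
    -- every ball contains a point where `g` is positive
    have hdense : Dense {x | 0 < g x} := Metric.dense_iff.2 fun p r hr ↦ by
      obtain ⟨x, hx, hlt⟩ := hcon p r hr
      exact ⟨x, hx, sub_pos.2 hlt⟩
    have hnonneg : ∀ x, 0 ≤ g x := fun x ↦ by
      have hcl : IsClosed {x | 0 ≤ g x} := isClosed_le continuous_const hgc
      exact closure_minimal (s := {x | 0 < g x}) (t := {x | 0 ≤ g x}) (fun y (hy : 0 < g y) ↦ hy.le)
        hcl (hdense x)
    -- the negative part of `g` vanishes, so `g` is integrable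
    obtain ⟨hi, hle⟩ := hint (Or.inr (by
      simp [ENNReal.ofReal_of_nonpos (neg_nonpos.2 (hnonneg _))]))
    have h0 : g =ᵐ[μ] 0 := (integral_eq_zero_iff_of_nonneg hnonneg hi).1
      (le_antisymm hle (integral_nonneg hnonneg))
    have hzero : g = 0 := Continuous.ae_eq_iff_eq μ hgc continuous_const |>.1 h0
    obtain ⟨x, -, hlt⟩ := hcon p₀ 1 one_pos
    have h1 : 0 < g x := sub_pos.2 hlt
    rw [hzero] at h1
    exact lt_irrefl _ h1
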